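/- Let $M$ be a compact (Hausdorff) finite-dimensional smooth manifold, possibly with boundary or corners, and let $\sigma=(\sigma_s)_{s\in\mathbb S^1}$ be a non-trivial smooth action on $M$ of the circle $\mathbb S^1=\mathbb R/\mathbb Z$ (of total length $1$); non-trivial means that $\sigma_s(p)\neq p$ for some $s$ and $p$. Equip $C^\infty(M)=C^\infty(M,\mathbb R)$ with its usual topology (uniform convergence on compact subsets of charts of all derivatives). For $s\in\mathbb S^1$ and $f\in C^\infty(M)$ put $\alpha_s f=f\circ\sigma_s$, and for an arc $I\subseteq\mathbb S^1$ define the linear operator $$\alpha_{\chi_I}:=\int_I\alpha_s\,ds\colon C^\infty(M)\to C^\infty(M),\qquad (\alpha_{\chi_I}f)(p)=\int_I f(\sigma_s(p))\,ds .$$ For every arc $I\subseteq\mathbb S^1$ of length $\ell\in[0,1]$ (with or without its end points), the following conditions are equivalent: (a) $\alpha_{\chi_I}$ is invertible on $C^\infty(M)$, i.e. bijective and continuous with continuous inverse; (b) $\alpha_{\chi_I}$ is a topological embedding, i.e. a homeomorphism onto its image; (c) $\alpha_{\chi_I}$ is surjective; (d) $\ell$ is irrational and not a Liouville number, where an irrational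 $x$ is a Liouville number if for every integer $N>0$ there are integers $p$ and $q>1$ with $\left|x-\frac pq\right|<\frac1{q^N}$. In particular, the set of lengths $\ell\in[0,1]$ for which $\alpha_{\chi_I}$ fails to be invertible for some arc $I$ of length $\ell$ has Lebesgue measure $0$. -/

import Mathlib

open scoped Manifold ContDiff Topology

section ParametricIntegral

set_option linter.unusedSectionVars false

variable {E F : Type*} [NormedAddCommGroup E] [NormedSpace ℝ E]
  [NormedAddCommGroup F] [NormedSpace ℝ F]

theorem integrable_of_continuous_circle {f : UnitAddCircle → F} (hf : Continuous f)
    (S : Set UnitAddCircle) :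
    MeasureTheory.Integrable f (MeasureTheory.volume.restrict S) :=
  hf.integrable_of_hasCompactSupport (HasCompactSupport.of_compactSpace f)

theorem eventually_forall_circle_norm_sub_lt {f : UnitAddCircle → E → F} {U : Set E}
    (hf : ContinuousOn (Function.uncurry f) (Set.univ ×ˢ U)) {x : E} (hx : x ∈ U)
    {ε : ℝ} (hε : 0 < ε) : ∀ᶠ y in 𝓝[U] x, ∀ s, ‖f s y - f s x‖ < ε := by
  have hF : Continuous fun p : U × UnitAddCircle => f p.2 p.1 :=
    hf.comp_continuous (f := fun p : U × UnitAddCircle => (p.2, (p.1 : E))) (by fun_prop)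
      fun p => ⟨Set.mem_univ _, p.1.2⟩
  have key : ∀ᶠ y : U in 𝓝 ⟨x, hx⟩, ∀ s ∈ (Set.univ : Set UnitAddCircle),
      ‖f s y - f s x‖ < ε := by
    refine isCompact_univ.eventually_forall_of_forall_eventually
      (P := fun (y : U) s => ‖f s y - f s x‖ < ε) fun s _ => ?_
    have hc : Continuous fun p : U × UnitAddCircle => ‖f p.2 p.1 - f p.2 x‖ :=
      (hF.sub (hF.comp (f := fun p : U × UnitAddCircle => ((⟨x, hx⟩ : U), p.2))
        (by fun_prop))).norm
    exact hc.continuousAt.eventually (gt_mem_nhds (by simpa using hε))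
  rw [nhdsWithin_eq_map_subtype_coe hx, Filter.eventually_map]
  filter_upwards [key] with y hy s using hy s (Set.mem_univ s)

theorem continuous_circle_slice {f : UnitAddCircle → E → F} {U : Set E}
    (hf : ContinuousOn (Function.uncurry f) (Set.univ ×ˢ U)) {x : E} (hx : x ∈ U) :
    Continuous fun s => f s x :=
  hf.comp_continuous (f := fun s : UnitAddCircle => (s, x)) (by fun_prop)
    fun s => ⟨Set.mem_univ _, hx⟩

theorem norm_circle_integral_le {f : UnitAddCircle → F} {C : ℝ} (hC : 0 ≤ C)
    (h : ∀ s, ‖f s‖ ≤ C) (S : Set UnitAddCircle) : ‖∫ s in S, f s‖ ≤ C := by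
  refine (MeasureTheory.norm_integral_le_of_norm_le_const
    (Filter.Eventually.of_forall h)).trans ?_
  have : (MeasureTheory.volume.restrict S).real Set.univ ≤ 1 := by
    have h1 : MeasureTheory.volume S ≤ (1 : ENNReal) :=
      (MeasureTheory.measure_mono (Set.subset_univ S)).trans
        (by rw [AddCircle.measure_univ]; simp)
    simpa [MeasureTheory.measureReal_def] using ENNReal.toReal_mono ENNReal.one_ne_top h1
  nlinarith

theorem continuousOn_circle_integral {f : UnitAddCircle → E → F} {U : Set E}
    (hf : ContinuousOn (Function.uncurry f) (Set.univ ×ˢ U)) (S : Set UnitAddCircle) :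
    ContinuousOn (fun y => ∫ s in S, f s y) U := by
  intro x hx
  rw [ContinuousWithinAt, Metric.tendsto_nhds]
  intro ε hε
  filter_upwards [eventually_forall_circle_norm_sub_lt hf hx (half_pos hε),
    self_mem_nhdsWithin] with y hy hyU
  rw [dist_eq_norm, ← MeasureTheory.integral_sub
    (integrable_of_continuous_circle (continuous_circle_slice hf hyU) S)
    (integrable_of_continuous_circle (continuous_circle_slice hf hx) S)]
  exact (norm_circle_integral_le (half_pos hε).le (fun s => (hy s).le) S).trans_lt
    (half_lt_self hε)

theorem hasFDerivWithinAt_circle_integral {f : UnitAddCircle → E → F}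
    {f' : UnitAddCircle → E → E →L[ℝ] F} {U : Set E} (hU : Convex ℝ U)
    (hf : ContinuousOn (Function.uncurry f) (Set.univ ×ˢ U))
    (hf' : ContinuousOn (Function.uncurry f') (Set.univ ×ˢ U))
    (hd : ∀ s, ∀ y ∈ U, HasFDerivWithinAt (f s) (f' s y) U y)
    (S : Set UnitAddCircle) {x : E} (hx : x ∈ U) :
    HasFDerivWithinAt (fun y => ∫ s in S, f s y) (∫ s in S, f' s x) U x := by
  rw [hasFDerivWithinAt_iff_isLittleO, Asymptotics.isLittleO_iff]
  intro ε hε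
  obtain ⟨δ, hδ, hball⟩ := Metric.mem_nhdsWithin_iff.1
    (eventually_forall_circle_norm_sub_lt hf' hx hε)
  filter_upwards [inter_mem_nhdsWithin U (Metric.ball_mem_nhds x hδ)] with y hy
  have hxB : x ∈ U ∩ Metric.ball x δ := ⟨hx, Metric.mem_ball_self hδ⟩
  have hi' := integrable_of_continuous_circle (continuous_circle_slice hf' hx) S
  have hi := integrable_of_continuous_circle (continuous_circle_slice hf hx) S
  have hiy := integrable_of_continuous_circle (continuous_circle_slice hf hy.1) S
  rw [ContinuousLinearMap.integral_apply hi', ← MeasureTheory.integral_sub hiy hi,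
    ← MeasureTheory.integral_sub (f := fun s => f s y - f s x) (hiy.sub hi)
      (hi'.apply_continuousLinearMap _)]
  refine norm_circle_integral_le (by positivity) (fun s => ?_) S
  exact (hU.inter (convex_ball x δ)).norm_image_sub_le_of_norm_hasFDerivWithin_le'
    (fun z hz => (hd s z hz.1).mono Set.inter_subset_left)
    (fun z hz => (hball ⟨hz.2, hz.1⟩ s).le) hxB hy

theorem contDiffOn_iteratedFDerivWithin_param {g : ℝ → E → F} {U : Set E}
    (hU : UniqueDiffOn ℝ U)
    (hg : ContDiffOn ℝ ∞ (Function.uncurry g) (Set.univ ×ˢ U)) (k : ℕ) :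
    ContDiffOn ℝ ∞ (Function.uncurry fun t => iteratedFDerivWithin ℝ k (g t) U)
      (Set.univ ×ˢ U) := by
  induction k with
  | zero =>
    simp only [iteratedFDerivWithin_zero_eq_comp]
    exact (continuousMultilinearCurryFin0 ℝ E F).symm.contDiff.comp_contDiffOn hg
  | succ k ih =>
    simp only [iteratedFDerivWithin_succ_eq_comp_left]
    let L : (E →L[ℝ] E [×k]→L[ℝ] F) ≃ₗᵢ[ℝ] (E [×(k + 1)]→L[ℝ] F) :=
      (continuousMultilinearCurryLeftEquiv ℝ (fun _ : Fin (k + 1) => E) F).symm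
    refine (LinearIsometryEquiv.contDiff (𝕜 := ℝ) (E := E →L[ℝ] E [×k]→L[ℝ] F)
      (F := E [×(k + 1)]→L[ℝ] F) L).comp_contDiffOn
      (f := fun p : ℝ × E => fderivWithin ℝ (iteratedFDerivWithin ℝ k (g p.1) U) U p.2) ?_
    intro p hp
    refine ContDiffWithinAt.fderivWithin (n := ∞)
      (f := fun (p : ℝ × E) y => iteratedFDerivWithin ℝ k (g p.1) U y) (g := Prod.snd) (t := U)
      ?_ contDiffWithinAt_snd hU (by simp) hp (fun q hq => hq.2)
    exact (ih p hp).comp (p, p.2) (f := fun q : (ℝ × E) × E => (q.1.1, q.2))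
      (by fun_prop) (fun q hq => ⟨Set.mem_univ _, hq.2⟩)

theorem continuousOn_circle_of_continuousOn_real {f : UnitAddCircle → E → F} {U : Set E}
    (hf : ContinuousOn (fun p : ℝ × E => f (p.1 : UnitAddCircle) p.2) (Set.univ ×ˢ U)) :
    ContinuousOn (Function.uncurry f) (Set.univ ×ˢ U) := by
  have hq : IsOpenQuotientMap
      (Prod.map ((↑) : ℝ → UnitAddCircle) (id : U → U)) :=
    QuotientAddGroup.isOpenQuotientMap_mk.prodMap .id
  have hc : Continuous fun p : UnitAddCircle × U => f p.1 p.2 := by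
    rw [hq.isQuotientMap.continuous_iff]
    exact hf.comp_continuous (f := fun p : ℝ × U => (p.1, (p.2 : E))) (by fun_prop)
      fun p => ⟨Set.mem_univ _, p.2.2⟩
  rw [continuousOn_iff_continuous_domRestrict]
  exact hc.comp (f := fun p : (Set.univ ×ˢ U : Set (UnitAddCircle × E)) =>
    (p.1.1, (⟨p.1.2, p.2.2⟩ : U))) (by fun_prop)

theorem contDiffOn_circle_integral {f : UnitAddCircle → E → F} {U : Set E} (hU : Convex ℝ U)
    (hU' : UniqueDiffOn ℝ U)
    (hf : ContDiffOn ℝ ∞ (fun p : ℝ × E => f (p.1 : UnitAddCircle) p.2) (Set.univ ×ˢ U))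
    (S : Set UnitAddCircle) : ContDiffOn ℝ ∞ (fun y => ∫ s in S, f s y) U := by
  have hc (k : ℕ) : ContinuousOn
      (Function.uncurry fun s => iteratedFDerivWithin ℝ k (f s) U) (Set.univ ×ˢ U) :=
    continuousOn_circle_of_continuousOn_real (f := fun s => iteratedFDerivWithin ℝ k (f s) U)
      (contDiffOn_iteratedFDerivWithin_param (g := fun t : ℝ => f t) hU' hf k).continuousOn
  have hs (s : UnitAddCircle) : ContDiffOn ℝ ∞ (f s) U := by
    obtain ⟨t, rfl⟩ := QuotientAddGroup.mk_surjective s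
    exact hf.comp (f := fun y : E => (t, y)) (by fun_prop) fun y hy => ⟨Set.mem_univ _, hy⟩
  have hT (s : UnitAddCircle) := (hs s).ftaylorSeriesWithin hU'
  refine HasFTaylorSeriesUpToOn.contDiffOn (n := ⊤)
    (f' := fun y k => ∫ s in S, iteratedFDerivWithin ℝ k (f s) U y) ⟨fun y hy => ?_,
      fun m _ y hy => ?_, fun m _ => continuousOn_circle_integral (hc m) S⟩
  · exact ((continuousMultilinearCurryFin0 ℝ E F).toContinuousLinearEquiv.integral_comp_comm
      (μ := MeasureTheory.volume.restrict S)
      fun s => iteratedFDerivWithin ℝ 0 (f s) U y).symm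
  · let L : (E [×(m + 1)]→L[ℝ] F) ≃ₗᵢ[ℝ] (E →L[ℝ] E [×m]→L[ℝ] F) :=
      continuousMultilinearCurryLeftEquiv ℝ (fun _ : Fin (m + 1) => E) F
    have key := hasFDerivWithinAt_circle_integral hU (hc m)
      (f' := fun s y => L (iteratedFDerivWithin ℝ (m + 1) (f s) U y))
      (L.continuous.comp_continuousOn (hc (m + 1)))
      (fun s z hz => (hT s).fderivWithin m (mod_cast ENat.natCast_lt_top m) z hz) S hy
    rw [show (∫ s in S, L (iteratedFDerivWithin ℝ (m + 1) (f s) U y)) =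
        L (∫ s in S, iteratedFDerivWithin ℝ (m + 1) (f s) U y) from
      ContinuousLinearEquiv.integral_comp_comm (𝕜 := ℝ) (E := E [×(m + 1)]→L[ℝ] F)
        (F := E →L[ℝ] E [×m]→L[ℝ] F) (μ := MeasureTheory.volume.restrict S)
        L.toContinuousLinearEquiv fun s => iteratedFDerivWithin ℝ (m + 1) (f s) U y] at key
    exact key

end ParametricIntegral

section SmoothFunctions

variable {E : Type*} [NormedAddCommGroup E] [NormedSpace ℝ E]
  {H : Type*} [TopologicalSpace H] (I : ModelWithCorners ℝ E H)
  {M : Type*} [TopologicalSpace M] [ChartedSpace H M]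

/-- The space `C^∞(M)` of smooth real functions carries the compact-open `C^∞`-topology: uniform
convergence of all chart derivatives on the compact subsets of the chart domains. This is the
coarsest topology for which all the maps `f ↦ D^k (f ∘ φ⁻¹)` are continuous, where `φ` is a chart
and the target has the topology of uniform convergence on compact subsets of the range of `φ`.
(Derivatives are taken within `range I`, so that boundary points are allowed.) -/
noncomputable instance smoothFunctionTopology : TopologicalSpace C^∞⟮I, M; ℝ⟯ :=
  ⨅ (x : M) (k : ℕ), TopologicalSpace.induced
    (fun f : C^∞⟮I, M; ℝ⟯ =>
      UniformOnFun.ofFun {K : Set E | IsCompact K ∧ K ⊆ (extChartAt I x).target}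
        (fun y => iteratedFDerivWithin ℝ k (fun z => f ((extChartAt I x).symm z))
          (Set.range I) y))
    (UniformOnFun.topologicalSpace E (E [×k]→L[ℝ] ℝ) _)

/-- An action of the circle `ℝ/ℤ` on `M` is smooth if the flow `(t, x) ↦ σ_t(x)` it defines is a
smooth map `ℝ × M → M` (the projection `ℝ → ℝ/ℤ` being a local diffeomorphism). -/
class SmoothCircleAction (M : Type*) [TopologicalSpace M] [ChartedSpace H M]
    [AddAction UnitAddCircle M] : Prop where
  contMDiff_flow : ContMDiff (𝓘(ℝ, ℝ).prod I) I ∞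
    fun p : ℝ × M => (p.1 : UnitAddCircle) +ᵥ p.2

variable [AddAction UnitAddCircle M] [SmoothCircleAction I M]

theorem continuous_orbit_function (f : C^∞⟮I, M; ℝ⟯) (x : M) :
    Continuous fun s : UnitAddCircle => f (s +ᵥ x) := by
  rw [(QuotientAddGroup.isOpenQuotientMap_mk (G := ℝ)).isQuotientMap.continuous_iff]
  have h : Continuous fun p : ℝ × M => (p.1 : UnitAddCircle) +ᵥ p.2 :=
    (SmoothCircleAction.contMDiff_flow (I := I)).continuous
  exact f.contMDiff.continuous.comp (h.comp (f := fun t : ℝ => (t, x)) (by fun_prop))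

theorem contMDiff_arc_integral [IsManifold I ∞ M] (f : C^∞⟮I, M; ℝ⟯) (A : Set UnitAddCircle) :
    ContMDiff I 𝓘(ℝ, ℝ) ∞ fun x => ∫ s in A, f (s +ᵥ x) := by
  intro x
  rw [contMDiffAt_iff_source, contMDiffWithinAt_iff_contDiffWithinAt]
  obtain ⟨r, hr, hball⟩ := Metric.mem_nhdsWithin_iff.1
    (extChartAt_target_mem_nhdsWithin (I := I) x)
  have hsmooth : ContMDiffOn 𝓘(ℝ, ℝ × E) 𝓘(ℝ, ℝ) ∞
      (fun p : ℝ × E => f ((p.1 : UnitAddCircle) +ᵥ (extChartAt I x).symm p.2))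
      (Set.univ ×ˢ (Set.range I ∩ Metric.ball (extChartAt I x x) r)) := by
    have h1 : ContMDiffOn 𝓘(ℝ, ℝ × E) (𝓘(ℝ, ℝ).prod I) ∞
        (fun p : ℝ × E => (p.1, (extChartAt I x).symm p.2))
        (Set.univ ×ˢ (Set.range I ∩ Metric.ball (extChartAt I x x) r)) :=
      contDiff_fst.contMDiff.contMDiffOn.prodMk
        ((contMDiffOn_extChartAt_symm x).comp contDiff_snd.contMDiff.contMDiffOn
          fun p hp => hball ⟨hp.2.2, hp.2.1⟩)
    exact (f.contMDiff.comp
      (SmoothCircleAction.contMDiff_flow (I := I) (M := M))).comp_contMDiffOn h1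
  have key := contDiffOn_circle_integral
    (f := fun s y => f (s +ᵥ (extChartAt I x).symm y))
    (I.convex_range.inter (convex_ball (extChartAt I x x) r))
    (I.uniqueDiffOn.inter Metric.isOpen_ball)
    (contMDiffOn_iff_contDiffOn.1 hsmooth) A
  refine (key _ ⟨extChartAt_target_subset_range x (mem_extChartAt_target x),
    Metric.mem_ball_self hr⟩).mono_of_mem_nhdsWithin ?_
  exact inter_mem_nhdsWithin _ (Metric.ball_mem_nhds _ hr)

/-- The operator `α_{χ_A} = ∫_A α_s ds` on `C^∞(M)`, where `α_s f = f ∘ σ_s` and `ds` is the Haar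
measure of total mass one on the circle `ℝ/ℤ`. -/
noncomputable def arcOperator [IsManifold I ∞ M] (A : Set UnitAddCircle) :
    C^∞⟮I, M; ℝ⟯ →ₗ[ℝ] C^∞⟮I, M; ℝ⟯ where
  toFun f := ⟨fun x => ∫ s in A, f (s +ᵥ x), contMDiff_arc_integral I f A⟩
  map_add' f g := by
    ext x
    exact MeasureTheory.integral_add
      (integrable_of_continuous_circle (continuous_orbit_function I f x) A)
      (integrable_of_continuous_circle (continuous_orbit_function I g x) A)
  map_smul' c f := by
    ext x
    exact MeasureTheory.integral_const_mul c fun s => f (s +ᵥ x)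

end SmoothFunctions

/-- `A` is an arc of length `ℓ` in the circle `ℝ/ℤ` of length one: the image of an interval with
end points `a` and `a + ℓ`, where each end point may or may not belong to the arc. -/
def IsArcOfLength (A : Set UnitAddCircle) (ℓ : ℝ) : Prop :=
  0 ≤ ℓ ∧ ℓ ≤ 1 ∧ ∃ a : ℝ,
    ((↑) : ℝ → UnitAddCircle) '' Set.Ioo a (a + ℓ) ⊆ A ∧
      A ⊆ ((↑) : ℝ → UnitAddCircle) '' Set.Icc a (a + ℓ)

/-- A linear endomorphism of a topological vector space is invertible if it is bijective and
continuous with continuous inverse. -/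
def IsTopInvertible {V : Type*} [AddCommGroup V] [Module ℝ V] [TopologicalSpace V]
    (T : V →ₗ[ℝ] V) : Prop :=
  ∃ e : V ≃L[ℝ] V, ∀ v, e v = T v

/-!
On the `n`-th Fourier mode of the circle action the operator `α_{χ_A} = ∫_A α_s ds` is
multiplication by the Fourier coefficient `c_n = ∫_A e^{2πinr} dr` of the arc (`arcCoeff`), where
`c_0 = ℓ` and `|c_n| = |sin (πnℓ)| / (π|n|)` for `n ≠ 0`. The theorem says that it is invertible on
smooth functions exactly when `1 / c_n` grows at most polynomially, which is the Diophantine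
condition on `ℓ`. A smooth function is determined by the Fourier coefficients of its restrictions to
the orbits (`eq_of_orbitCoeff_eq`), so identities between operators are checked on modes.

If `ℓ` is neither rational nor a Liouville number, choose `k` so large that
`b_n = 1 / (c_n (2πin) ^ k)` is summable; then there is a continuous function `h` on the circle with
these coefficients (`IsArcOfLength.exists_convolution_inverse`). With `X` the generator of the
action, `f ↦ ∫ h(s) α_s (X ^ k f) ds + ℓ⁻¹ ∫ α_s f ds` is inverse to `α_{χ_A}`
(`isTopInvertible_arcOperator`). Continuity of both operators follows from that of `X`
(`continuous_generator`) and of weighted averages over the action (`continuous_orbitOperator`); the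
latter rests on the equicontinuity of the `α_s` (`eventually_norm_flow_lt`) and on differentiation
under the integral sign at boundary points (`hasFTaylorSeriesUpToOn_integral_of_dominated`).

If `ℓ` is rational or a Liouville number, then for all `m ≠ 0` and `N` there is `b ≥ 2` with
`|c_{bm}| ≤ b ^ (-N)`. A non-trivial action has a smooth eigenfunction `u` of some weight `m ≠ 0`
with maximal modulus one (`exists_eigenfunction`), and `u ^ b` has weight `bm`, while its
derivatives grow only polynomially in `b`. Along suitable `b_i` the images of `Re u ^ b_i`
therefore tend to zero although the functions do not (`not_isEmbedding_arcOperator`), and the smooth function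
`∑ b_i ^ (-i) Re u ^ b_i` has no preimage, since the Fourier coefficients of a preimage along an
orbit would be unbounded (`not_surjective_arcOperator`). Rational and Liouville numbers form a null
set.
-/

/-! ### Calculus on convex sets -/

section NormedSpaces

open MeasureTheory

variable {E F : Type*} [NormedAddCommGroup E] [NormedSpace ℝ E]
  [NormedAddCommGroup F] [NormedSpace ℝ F]

theorem hasFDerivWithinAt_integral_of_dominated {α : Type*} [MeasurableSpace α] {μ : Measure α}
    {f : α → E → F} {f' : α → E → E →L[ℝ] F} {U : Set E} (hU : Convex ℝ U)
    (hf : ∀ y ∈ U, Integrable (fun a => f a y) μ)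
    (hf' : ∀ y ∈ U, Integrable (fun a => f' a y) μ)
    (hd : ∀ a, ∀ y ∈ U, HasFDerivWithinAt (f a) (f' a y) U y)
    {B : α → ℝ} (hB : Integrable B μ) (hbound : ∀ a, ∀ y ∈ U, ‖f' a y‖ ≤ B a)
    {x : E} (hx : x ∈ U) :
    HasFDerivWithinAt (fun y => ∫ a, f a y ∂μ) (∫ a, f' a x ∂μ) U x := by
  rw [hasFDerivWithinAt_iff_tendsto]
  have h0 : Filter.Tendsto (fun y => ∫ a, ‖y - x‖⁻¹ • (f a y - f a x - f' a x (y - x)) ∂μ)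
      (𝓝[U] x) (𝓝 (∫ _, (0 : F) ∂μ)) := by
    refine tendsto_integral_filter_of_dominated_convergence (fun a => 2 * B a) ?_ ?_
      (hB.const_mul 2) (Filter.Eventually.of_forall fun a => ?_)
    · filter_upwards [self_mem_nhdsWithin] with y hy
      exact (((hf y hy).sub (hf x hx)).sub
        ((hf' x hx).apply_continuousLinearMap (y - x))).aestronglyMeasurable.const_smul _
    · filter_upwards [self_mem_nhdsWithin] with y hy
      refine Filter.Eventually.of_forall fun a => ?_
      have h1 : ‖f a y - f a x‖ ≤ B a * ‖y - x‖ :=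
        hU.norm_image_sub_le_of_norm_hasFDerivWithin_le (fun z hz => hd a z hz)
          (fun z hz => hbound a z hz) hx hy
      have h2 : ‖f' a x (y - x)‖ ≤ B a * ‖y - x‖ :=
        (f' a x).le_of_opNorm_le (hbound a x hx) _
      have h3 : ‖f a y - f a x - f' a x (y - x)‖ ≤ 2 * B a * ‖y - x‖ :=
        (norm_sub_le _ _).trans (by linarith)
      have hB0 : 0 ≤ B a := (norm_nonneg _).trans (hbound a x hx)
      rw [norm_smul, norm_inv, norm_norm]
      calc ‖y - x‖⁻¹ * ‖f a y - f a x - f' a x (y - x)‖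
          ≤ ‖y - x‖⁻¹ * (2 * B a * ‖y - x‖) := by gcongr
        _ = 2 * B a * (‖y - x‖⁻¹ * ‖y - x‖) := by ring
        _ ≤ 2 * B a * 1 := by gcongr; exact inv_mul_le_one
        _ = 2 * B a := mul_one _
    · have := hasFDerivWithinAt_iff_tendsto.1 (hd a x hx)
      rw [tendsto_zero_iff_norm_tendsto_zero]
      simpa [norm_smul] using this
  rw [integral_zero, tendsto_zero_iff_norm_tendsto_zero] at h0
  refine h0.congr' ?_
  filter_upwards [self_mem_nhdsWithin] with y hy
  rw [integral_smul, norm_smul, norm_inv, norm_norm, integral_sub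
    (f := fun a => f a y - f a x) ((hf y hy).sub (hf x hx))
    ((hf' x hx).apply_continuousLinearMap _), integral_sub (hf y hy) (hf x hx),
    ContinuousLinearMap.integral_apply (hf' x hx)]

/-- Differentiation under the integral sign to all orders on a convex set, boundary points
included. With the counting measure it is a theorem on termwise differentiation of series. -/
theorem hasFTaylorSeriesUpToOn_integral_of_dominated [CompleteSpace F] {α : Type*}
    [MeasurableSpace α] {μ : Measure α}
    {f : α → E → F} {U : Set E} (hU : Convex ℝ U) (hU' : UniqueDiffOn ℝ U)
    (hf : ∀ a, ContDiffOn ℝ ∞ (f a) U)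
    (hmeas : ∀ k : ℕ, ∀ y ∈ U, AEStronglyMeasurable (fun a => iteratedFDerivWithin ℝ k (f a) U y) μ)
    {B : ℕ → α → ℝ} (hB : ∀ k, Integrable (B k) μ)
    (hbound : ∀ k a, ∀ y ∈ U, ‖iteratedFDerivWithin ℝ k (f a) U y‖ ≤ B k a) :
    HasFTaylorSeriesUpToOn ∞ (fun y => ∫ a, f a y ∂μ)
      (fun y k => ∫ a, iteratedFDerivWithin ℝ k (f a) U y ∂μ) U := by
  have hint (k : ℕ) (y : E) (hy : y ∈ U) :
      Integrable (fun a => iteratedFDerivWithin ℝ k (f a) U y) μ :=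
    (hB k).mono' (hmeas k y hy) (Filter.Eventually.of_forall fun a => hbound k a y hy)
  have hT (a : α) := (hf a).ftaylorSeriesWithin hU'
  have key (m : ℕ) (y : E) (hy : y ∈ U) : HasFDerivWithinAt
      (fun y => ∫ a, iteratedFDerivWithin ℝ m (f a) U y ∂μ)
      ((∫ a, iteratedFDerivWithin ℝ (m + 1) (f a) U y ∂μ).curryLeft) U y := by
    let L : (E [×(m + 1)]→L[ℝ] F) ≃ₗᵢ[ℝ] (E →L[ℝ] E [×m]→L[ℝ] F) :=
      continuousMultilinearCurryLeftEquiv ℝ (fun _ : Fin (m + 1) => E) F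
    have := hasFDerivWithinAt_integral_of_dominated (F := E [×m]→L[ℝ] F) (μ := μ) hU (hint m)
      (f' := fun a y => L (iteratedFDerivWithin ℝ (m + 1) (f a) U y))
      (fun y hy => (hB (m + 1)).mono'
        (L.continuous.comp_aestronglyMeasurable (hmeas (m + 1) y hy))
        (Filter.Eventually.of_forall fun a => (L.norm_map _).trans_le (hbound (m + 1) a y hy)))
      (fun a z hz => (hT a).fderivWithin m (mod_cast ENat.natCast_lt_top m) z hz)
      (hB (m + 1)) (fun a y hy => (L.norm_map _).trans_le (hbound (m + 1) a y hy)) hy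
    rw [show (∫ a, L (iteratedFDerivWithin ℝ (m + 1) (f a) U y) ∂μ) =
        L (∫ a, iteratedFDerivWithin ℝ (m + 1) (f a) U y ∂μ) from
      ContinuousLinearEquiv.integral_comp_comm (𝕜 := ℝ) (E := E [×(m + 1)]→L[ℝ] F)
        (F := E →L[ℝ] E [×m]→L[ℝ] F) (μ := μ)
        L.toContinuousLinearEquiv fun a => iteratedFDerivWithin ℝ (m + 1) (f a) U y] at this
    exact this
  refine ⟨fun y hy => ?_, fun m _ => key m, fun m _ y hy => (key m y hy).continuousWithinAt⟩
  exact ((continuousMultilinearCurryFin0 ℝ E F).toContinuousLinearEquiv.integral_comp_comm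
    (μ := μ) fun a => iteratedFDerivWithin ℝ 0 (f a) U y).symm

/-- The derivatives in the second variable depend smoothly on both variables. -/
theorem contDiffOn_iteratedFDerivWithin_slice {g : ℝ → E → F} {T : Set ℝ} {U : Set E}
    (hU : UniqueDiffOn ℝ U)
    (hg : ContDiffOn ℝ ∞ (Function.uncurry g) (T ×ˢ U)) (k : ℕ) :
    ContDiffOn ℝ ∞ (Function.uncurry fun t => iteratedFDerivWithin ℝ k (g t) U) (T ×ˢ U) := by
  induction k with
  | zero =>
    simp only [iteratedFDerivWithin_zero_eq_comp]
    exact (continuousMultilinearCurryFin0 ℝ E F).symm.contDiff.comp_contDiffOn hg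
  | succ k ih =>
    simp only [iteratedFDerivWithin_succ_eq_comp_left]
    let L : (E →L[ℝ] E [×k]→L[ℝ] F) ≃ₗᵢ[ℝ] (E [×(k + 1)]→L[ℝ] F) :=
      (continuousMultilinearCurryLeftEquiv ℝ (fun _ : Fin (k + 1) => E) F).symm
    refine (LinearIsometryEquiv.contDiff (𝕜 := ℝ) (E := E →L[ℝ] E [×k]→L[ℝ] F)
      (F := E [×(k + 1)]→L[ℝ] F) L).comp_contDiffOn
      (f := fun p : ℝ × E => fderivWithin ℝ (iteratedFDerivWithin ℝ k (g p.1) U) U p.2) ?_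
    intro p hp
    refine ContDiffWithinAt.fderivWithin (n := ∞)
      (f := fun (p : ℝ × E) y => iteratedFDerivWithin ℝ k (g p.1) U y) (g := Prod.snd) (t := U)
      ?_ contDiffWithinAt_snd hU (by simp) hp (fun q hq => hq.2)
    refine (ih p hp).comp (p, p.2) (f := fun q : (ℝ × E) × E => (q.1.1, q.2))
      (by fun_prop) ?_
    rintro ⟨q, z⟩ hq
    exact ⟨hq.1.1, hq.2⟩

/-- On the unit disc the derivatives of the powers `w ^ j` grow at most polynomially in `j`. -/
theorem exists_norm_iteratedFDerivWithin_pow_le {w : E → ℂ} {V : Set E} (hV : UniqueDiffOn ℝ V)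
    (hw : ContDiffOn ℝ ∞ w V) (hw1 : ∀ y ∈ V, ‖w y‖ ≤ 1) {K : Set E} (hK : IsCompact K)
    (hKV : K ⊆ V) (k : ℕ) :
    ∃ C : ℝ, 0 ≤ C ∧ ∀ j : ℕ, ∀ y ∈ K,
      ‖iteratedFDerivWithin ℝ k (fun z => w z ^ j) V y‖ ≤ C * ((j : ℝ) + 1) ^ k := by
  have hDw (i : ℕ) : ∃ D : ℝ, 0 ≤ D ∧
      ∀ y ∈ K, ‖iteratedFDerivWithin ℝ i (fderivWithin ℝ w V) V y‖ ≤ D := by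
    have hc := (hw.fderivWithin (m := ∞) hV (by simp)).continuousOn_iteratedFDerivWithin
      (m := i) (mod_cast le_top) hV
    obtain ⟨D, hD⟩ := hK.exists_bound_of_continuousOn (hc.mono hKV)
    exact ⟨max D 0, le_max_right _ _, fun y hy => (hD y hy).trans (le_max_left _ _)⟩
  choose D hD0 hD using hDw
  induction k using Nat.strong_induction_on with
  | _ k ih =>
  cases k with
  | zero =>
    refine ⟨1, zero_le_one, fun j y hy => ?_⟩
    simpa using pow_le_one₀ (norm_nonneg _) (hw1 y (hKV hy))
  | succ k =>
    choose! C hC0 hC using ih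
    refine ⟨∑ i ∈ Finset.range (k + 1), (k.choose i : ℝ) * C i * D (k - i),
      Finset.sum_nonneg fun i hi => ?_, fun j y hy => ?_⟩
    · have := hC0 i (by simpa using hi)
      have := hD0 (k - i)
      positivity
    cases j with
    | zero =>
      have h0 : ‖iteratedFDerivWithin ℝ (k + 1) (fun z => w z ^ 0) V y‖ = 0 := by
        simp [iteratedFDerivWithin_succ_const]
      rw [h0]
      refine mul_nonneg (Finset.sum_nonneg fun i hi => ?_) (by positivity)
      have := hC0 i (by simpa using hi)
      have := hD0 (k - i)
      positivity
    | succ j =>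
      have hder : Set.EqOn (fderivWithin ℝ (fun z => w z ^ (j + 1)) V)
          (fun z => ((j + 1 : ℕ) : ℝ) • (w z ^ j • fderivWithin ℝ w V z)) V := by
        intro z hz
        have h1 : HasFDerivWithinAt w (fderivWithin ℝ w V z) V z :=
          ((hw.differentiableOn (by simp)) z hz).hasFDerivWithinAt
        rw [(h1.pow (j + 1)).fderivWithin (hV z hz)]
        ext v
        simp [mul_assoc]
      rw [← norm_iteratedFDerivWithin_fderivWithin hV (hKV hy),
        iteratedFDerivWithin_congr hder (hKV hy)]
      have hp : ContDiffOn ℝ ∞ (fun z => w z ^ j) V := hw.pow j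
      have hf' : ContDiffOn ℝ ∞ (fderivWithin ℝ w V) V := hw.fderivWithin hV (by simp)
      have hsm : iteratedFDerivWithin ℝ k
            (fun z => ((j + 1 : ℕ) : ℝ) • (w z ^ j • fderivWithin ℝ w V z)) V y =
          ((j + 1 : ℕ) : ℝ) •
            iteratedFDerivWithin ℝ k (fun z => w z ^ j • fderivWithin ℝ w V z) V y :=
        iteratedFDerivWithin_const_smul_apply (a := ((j + 1 : ℕ) : ℝ))
          (f := fun z => w z ^ j • fderivWithin ℝ w V z)
          (((hp.smul hf') y (hKV hy)).of_le (mod_cast le_top)) hV (hKV hy)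
      rw [hsm, norm_smul]
      have hL := norm_iteratedFDerivWithin_smul_le (n := k) (N := ∞) hp hf' hV (hKV hy)
        (mod_cast le_top)
      have hj1 : (1 : ℝ) ≤ (j : ℝ) + 1 := by linarith [Nat.cast_nonneg (α := ℝ) j]
      have hsum : ∑ i ∈ Finset.range (k + 1), (k.choose i : ℝ) *
            ‖iteratedFDerivWithin ℝ i (fun z => w z ^ j) V y‖ *
            ‖iteratedFDerivWithin ℝ (k - i) (fderivWithin ℝ w V) V y‖ ≤
          ∑ i ∈ Finset.range (k + 1), (k.choose i : ℝ) * C i * D (k - i) * ((j : ℝ) + 1) ^ k := by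
        refine Finset.sum_le_sum fun i hi => ?_
        have hik : i < k + 1 := by simpa using hi
        have hi' := hC i hik j y hy
        have hCi := hC0 i hik
        calc _ ≤ (k.choose i : ℝ) * (C i * ((j : ℝ) + 1) ^ i) * D (k - i) := by
              gcongr
              exact hD _ y hy
          _ ≤ (k.choose i : ℝ) * (C i * ((j : ℝ) + 1) ^ k) * D (k - i) := by
              gcongr
              · exact hD0 _
              · omega
          _ = _ := by ring
      rw [← Finset.sum_mul] at hsum
      have hS : 0 ≤ ∑ i ∈ Finset.range (k + 1), (k.choose i : ℝ) * C i * D (k - i) :=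
        Finset.sum_nonneg fun i hi => by
          have := hC0 i (by simpa using hi)
          have := hD0 (k - i)
          positivity
      calc ‖((j + 1 : ℕ) : ℝ)‖ * _ ≤ ((j : ℝ) + 1) * ((∑ i ∈ Finset.range (k + 1),
              (k.choose i : ℝ) * C i * D (k - i)) * ((j : ℝ) + 1) ^ k) := by
            gcongr
            · simp
              rw [abs_of_nonneg (by positivity)]
            · exact hL.trans hsum
        _ = (∑ i ∈ Finset.range (k + 1), (k.choose i : ℝ) * C i * D (k - i)) *
              ((j : ℝ) + 1) ^ (k + 1) := by ring
        _ ≤ _ := by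
            push_cast
            gcongr
            linarith

end NormedSpaces

/-! ### The topology of `C^∞(M)` -/

section SmoothTopology

open Set Filter

variable {E : Type*} [NormedAddCommGroup E] [NormedSpace ℝ E]
  {H : Type*} [TopologicalSpace H] {I : ModelWithCorners ℝ E H}
  {M : Type*} [TopologicalSpace M] [ChartedSpace H M]

/-- The set `(extChartAt I x).target` is relatively open in `range I`, so derivatives within the two
sets agree. -/
theorem iteratedFDerivWithin_range_eq {F : Type*} [NormedAddCommGroup F] [NormedSpace ℝ F] (x : M)
    (k : ℕ) (g : E → F) {y : E} (hy : y ∈ (extChartAt I x).target) :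
    iteratedFDerivWithin ℝ k g (range I) y =
      iteratedFDerivWithin ℝ k g (extChartAt I x).target y := by
  refine iteratedFDerivWithin_congr_set ?_ k
  have := extChartAt_target_mem_nhdsWithin_of_mem (I := I) hy
  filter_upwards [mem_nhdsWithin_iff_eventually.1 this] with z hz
  exact propext ⟨hz, fun h => extChartAt_target_subset_range x h⟩

theorem ContMDiff.contDiffOn_comp_extChartAt_symm [IsManifold I ∞ M] {F : Type*}
    [NormedAddCommGroup F] [NormedSpace ℝ F] {f : M → F} (hf : ContMDiff I 𝓘(ℝ, F) ∞ f) (x : M) :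
    ContDiffOn ℝ ∞ (fun z => f ((extChartAt I x).symm z)) (extChartAt I x).target :=
  contMDiffOn_iff_contDiffOn.1 (hf.comp_contMDiffOn (contMDiffOn_extChartAt_symm x))

/-- Convergence in `C^∞(M)`. Derivatives within the open piece `(extChartAt I x).target` of the
model are used in place of derivatives within `range I`; they agree there. -/
theorem tendsto_smooth_iff [IsManifold I ∞ M] {ι : Type*} {l : Filter ι} {F : ι → C^∞⟮I, M; ℝ⟯}
    {f : C^∞⟮I, M; ℝ⟯} :
    Tendsto F l (𝓝 f) ↔ ∀ (x : M) (k : ℕ) (K : Set E), IsCompact K →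
      K ⊆ (extChartAt I x).target → ∀ ε > 0, ∀ᶠ i in l, ∀ y ∈ K,
        ‖iteratedFDerivWithin ℝ k (fun z => (F i - f) ((extChartAt I x).symm z))
          (extChartAt I x).target y‖ < ε := by
  have hV (x : M) := uniqueDiffOn_extChartAt_target (I := I) x
  have hsm (g : C^∞⟮I, M; ℝ⟯) (x : M) := g.contMDiff.contDiffOn_comp_extChartAt_symm x
  simp only [nhds_iInf, tendsto_iInf, nhds_induced, tendsto_comap_iff]
  refine forall_congr' fun x => forall_congr' fun k => ?_
  rw [UniformOnFun.tendsto_iff_tendstoUniformlyOn]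
  simp only [mem_ofPred_eq, and_imp, Metric.tendstoUniformlyOn_iff]
  refine forall_congr' fun K => forall_congr' fun _ => forall_congr' fun hKV =>
    forall_congr' fun ε => forall_congr' fun _ =>
      eventually_congr (Eventually.of_forall fun i => ?_)
  refine forall_congr' fun y => forall_congr' fun hy => ?_
  have e1 : iteratedFDerivWithin ℝ k (fun z => (F i - f) ((extChartAt I x).symm z))
      (extChartAt I x).target y =
      iteratedFDerivWithin ℝ k (fun z => F i ((extChartAt I x).symm z))
        (extChartAt I x).target y -
      iteratedFDerivWithin ℝ k (fun z => f ((extChartAt I x).symm z))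
        (extChartAt I x).target y :=
    iteratedFDerivWithin_sub_apply ((hsm (F i) x y (hKV hy)).of_le (mod_cast le_top))
      ((hsm f x y (hKV hy)).of_le (mod_cast le_top)) (hV x) (hKV hy)
  rw [e1, ← iteratedFDerivWithin_range_eq x k _ (hKV hy),
    ← iteratedFDerivWithin_range_eq x k _ (hKV hy), dist_comm, dist_eq_norm]
  rfl

theorem eventually_nhds_zero_smooth [IsManifold I ∞ M] (x : M) (k : ℕ) {K : Set E}
    (hK : IsCompact K) (hKV : K ⊆ (extChartAt I x).target) {ε : ℝ} (hε : 0 < ε) :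
    ∀ᶠ f in 𝓝 (0 : C^∞⟮I, M; ℝ⟯), ∀ y ∈ K,
      ‖iteratedFDerivWithin ℝ k (fun z => f ((extChartAt I x).symm z))
          (extChartAt I x).target y‖ < ε := by
  have := tendsto_smooth_iff.1 (tendsto_id (α := C^∞⟮I, M; ℝ⟯) (x := 𝓝 0)) x k K hK hKV ε hε
  simpa using this

theorem continuous_of_eventually_nhds_zero [IsManifold I ∞ M]
    {T : C^∞⟮I, M; ℝ⟯ →ₗ[ℝ] C^∞⟮I, M; ℝ⟯}
    (hT : ∀ (x : M) (k : ℕ) (K : Set E), IsCompact K → K ⊆ (extChartAt I x).target → ∀ ε > 0,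
      ∀ᶠ f in 𝓝 (0 : C^∞⟮I, M; ℝ⟯), ∀ y ∈ K,
        ‖iteratedFDerivWithin ℝ k (fun z => T f ((extChartAt I x).symm z))
          (extChartAt I x).target y‖ < ε) : Continuous T := by
  refine continuous_iff_continuousAt.2 fun f => tendsto_smooth_iff.2 fun x k K hK hKV ε hε => ?_
  have h0 : Tendsto (fun g => g - f) (𝓝 f) (𝓝 (0 : C^∞⟮I, M; ℝ⟯)) :=
    tendsto_smooth_iff.2 fun x k K hK hKV ε hε => by
      simpa using tendsto_smooth_iff.1 (tendsto_id (α := C^∞⟮I, M; ℝ⟯) (x := 𝓝 f)) x k K hK hKV ε hε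
  simpa only [map_sub] using h0.eventually (hT x k K hK hKV ε hε)

theorem continuous_eval_smooth [IsManifold I ∞ M] (p : M) :
    Continuous fun f : C^∞⟮I, M; ℝ⟯ => f p := by
  refine continuous_iff_continuousAt.2 fun f => Metric.tendsto_nhds.2 fun ε hε => ?_
  have := tendsto_smooth_iff.1 (tendsto_id (α := C^∞⟮I, M; ℝ⟯) (x := 𝓝 f)) p 0
    {extChartAt I p p} isCompact_singleton (by simp) ε hε
  filter_upwards [this] with g hg
  simpa [dist_eq_norm] using hg

/-- Points of the image of a chart have convex relatively compact neighbourhoods in it. Convexity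
serves the mean value inequality, which is also needed at boundary points. -/
theorem exists_convex_extChartAt_target_inter [FiniteDimensional ℝ E] (x : M) {y : E}
    (hy : y ∈ (extChartAt I x).target) :
    ∃ O : Set E, IsOpen O ∧ y ∈ O ∧ Convex ℝ ((extChartAt I x).target ∩ O) ∧
      ∃ K : Set E, IsCompact K ∧ (extChartAt I x).target ∩ O ⊆ K ∧
        K ⊆ (extChartAt I x).target := by
  have : ProperSpace E := FiniteDimensional.proper ℝ E
  obtain ⟨r, hr, hb⟩ := Metric.mem_nhdsWithin_iff.1
    (extChartAt_target_mem_nhdsWithin_of_mem (I := I) hy)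
  have hsub := extChartAt_target_subset_range (I := I) x
  refine ⟨Metric.ball y (r / 2), Metric.isOpen_ball, Metric.mem_ball_self (half_pos hr), ?_,
    Metric.closedBall y (r / 2) ∩ range I,
    (isCompact_closedBall y (r / 2)).inter_right I.isClosed_range,
    fun z hz => ⟨Metric.ball_subset_closedBall hz.2, hsub hz.1⟩, ?_⟩
  · have : (extChartAt I x).target ∩ Metric.ball y (r / 2) =
        range I ∩ Metric.ball y (r / 2) :=
      Subset.antisymm (fun z hz => ⟨hsub hz.1, hz.2⟩)
        fun z hz => ⟨hb ⟨Metric.ball_subset_ball (half_le_self hr.le) hz.2, hz.1⟩, hz.2⟩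
    rw [this]
    exact I.convex_range.inter (convex_ball _ _)
  · rintro z ⟨hz1, hz2⟩
    exact hb ⟨Metric.closedBall_subset_ball (half_lt_self hr) hz1, hz2⟩

theorem contMDiff_of_contDiffOn_extChartAt [IsManifold I ∞ M] {F : Type*} [NormedAddCommGroup F]
    [NormedSpace ℝ F] {g : M → F}
    (hg : ∀ x : M, ∃ O : Set E, IsOpen O ∧ extChartAt I x x ∈ O ∧
      ContDiffOn ℝ ∞ (fun z => g ((extChartAt I x).symm z)) ((extChartAt I x).target ∩ O)) :
    ContMDiff I 𝓘(ℝ, F) ∞ g := by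
  intro x
  rw [contMDiffAt_iff_source, contMDiffWithinAt_iff_contDiffWithinAt]
  obtain ⟨O, hO, hxO, hc⟩ := hg x
  refine (hc _ ⟨mem_extChartAt_target x, hxO⟩).mono_of_mem_nhdsWithin ?_
  exact inter_mem (extChartAt_target_mem_nhdsWithin x)
    (mem_nhdsWithin_of_mem_nhds (hO.mem_nhds hxO))

end SmoothTopology

/-! ### Averages over the circle action -/

section Action

open Set Filter MeasureTheory

variable {E : Type*} [NormedAddCommGroup E] [NormedSpace ℝ E]
  {H : Type*} [TopologicalSpace H] {I : ModelWithCorners ℝ E H}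
  {M : Type*} [TopologicalSpace M] [ChartedSpace H M] [IsManifold I ∞ M]
  [AddAction UnitAddCircle M] [SmoothCircleAction I M]

variable (I) in
theorem contMDiffOn_flow_extChartAt_symm (x : M) :
    ContMDiffOn 𝓘(ℝ, ℝ × E) I ∞
      (fun p : ℝ × E => (p.1 : UnitAddCircle) +ᵥ (extChartAt I x).symm p.2)
      (univ ×ˢ (extChartAt I x).target) := by
  have h1 : ContMDiffOn 𝓘(ℝ, ℝ × E) (𝓘(ℝ, ℝ).prod I) ∞
      (fun p : ℝ × E => (p.1, (extChartAt I x).symm p.2)) (univ ×ˢ (extChartAt I x).target) :=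
    contDiff_fst.contMDiff.contMDiffOn.prodMk
      ((contMDiffOn_extChartAt_symm x).comp contDiff_snd.contMDiff.contMDiffOn fun p hp => hp.2)
  exact (SmoothCircleAction.contMDiff_flow (I := I) (M := M)).comp_contMDiffOn h1

theorem contDiffOn_comp_flow (f : C^∞⟮I, M; ℝ⟯) (x : M) :
    ContDiffOn ℝ ∞
      (fun p : ℝ × E => f ((p.1 : UnitAddCircle) +ᵥ (extChartAt I x).symm p.2))
      (univ ×ˢ (extChartAt I x).target) :=
  contMDiffOn_iff_contDiffOn.1
    (f.contMDiff.comp_contMDiffOn (contMDiffOn_flow_extChartAt_symm I x))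

/-- Local form of the equicontinuity of the operators `f ↦ f ∘ σ_t`: near a point of the chart at
`x` and a time `t₀`, the translates of `f` are controlled by the derivatives of `f` in the chart at
the translated point. -/
theorem exists_nhdsWithin_eventually_norm_flow_lt [FiniteDimensional ℝ E] (x : M) (k : ℕ) {ε : ℝ}
    (hε : 0 < ε) (t₀ : ℝ) {y₀ : E} (hy₀ : y₀ ∈ (extChartAt I x).target) :
    ∃ W ∈ 𝓝[univ ×ˢ (extChartAt I x).target] (t₀, y₀), ∀ᶠ f in 𝓝 (0 : C^∞⟮I, M; ℝ⟯), ∀ p ∈ W,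
      ‖iteratedFDerivWithin ℝ k
        (fun z => f ((p.1 : UnitAddCircle) +ᵥ (extChartAt I x).symm z))
        (extChartAt I x).target p.2‖ < ε := by
  set x' : M := (t₀ : UnitAddCircle) +ᵥ (extChartAt I x).symm y₀ with hx'
  set V := (extChartAt I x).target with hV
  have hflow := contMDiffOn_flow_extChartAt_symm I x
  let Ψ : ℝ → E → E := fun t z => extChartAt I x' ((t : UnitAddCircle) +ᵥ (extChartAt I x).symm z)
  have hsrc := (hflow.continuousOn (t₀, y₀) ⟨mem_univ _, hy₀⟩).preimage_mem_nhdsWithin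
    (extChartAt_source_mem_nhds (I := I) x')
  obtain ⟨O', hO', hmem', hsub'⟩ := mem_nhdsWithin.1 hsrc
  obtain ⟨T, O, hT, hO, ht₀, hy₀O, hTO⟩ := isOpen_prod_iff.1 hO' t₀ y₀ hmem'
  have hmaps : ∀ p ∈ T ×ˢ (V ∩ O),
      (p.1 : UnitAddCircle) +ᵥ (extChartAt I x).symm p.2 ∈ (extChartAt I x').source :=
    fun p hp => hsub' ⟨hTO ⟨hp.1, hp.2.2⟩, mem_univ _, hp.2.1⟩
  have hΨ : ContDiffOn ℝ ∞ (Function.uncurry Ψ) (T ×ˢ (V ∩ O)) :=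
    contMDiffOn_iff_contDiffOn.1 ((contMDiffOn_extChartAt (x := x')).comp
      (hflow.mono fun p hp => ⟨mem_univ _, hp.2.1⟩)
      fun p hp => by simpa using hmaps p hp)
  have hU : UniqueDiffOn ℝ (V ∩ O) := (uniqueDiffOn_extChartAt_target x).inter hO
  have hp₀ : (t₀, y₀) ∈ T ×ˢ (V ∩ O) := ⟨ht₀, hy₀, hy₀O⟩
  have hnhds : 𝓝[T ×ˢ (V ∩ O)] (t₀, y₀) = 𝓝[univ ×ˢ V] (t₀, y₀) := by
    have : T ×ˢ (V ∩ O) = (univ ×ˢ V) ∩ (T ×ˢ O) := by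
      ext p
      simp only [mem_prod, mem_inter_iff, mem_univ]
      tauto
    rw [this, nhdsWithin_inter_of_mem' (mem_nhdsWithin_of_mem_nhds
      ((hT.prod hO).mem_nhds ⟨ht₀, hy₀O⟩))]
  let G : ℕ → ℝ × E → ℝ := fun i p => ‖iteratedFDerivWithin ℝ i (Ψ p.1) (V ∩ O) p.2‖
  have hG (i : ℕ) : ContinuousWithinAt (G i) (T ×ˢ (V ∩ O)) (t₀, y₀) :=
    ((contDiffOn_iteratedFDerivWithin_slice hU hΨ i).continuousOn.norm) _ hp₀
  -- `D ≥ 1`, so that a bound by `D` gives the bounds by `D ^ i` which Faà di Bruno's formula needs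
  let D : ℝ := 1 + ∑ i ∈ Finset.range (k + 1), G i (t₀, y₀)
  have hD1 : 1 ≤ D := le_add_of_nonneg_right (Finset.sum_nonneg fun i _ => norm_nonneg _)
  have hGD : ∀ᶠ p in 𝓝[T ×ˢ (V ∩ O)] (t₀, y₀), ∀ i ∈ Finset.range (k + 1), G i p < D := by
    rw [eventually_all_finset]
    intro i hi
    refine (hG i).eventually_lt_const ?_
    have := Finset.single_le_sum (f := fun i => G i (t₀, y₀)) (fun i _ => norm_nonneg _) hi
    simp only [D]
    linarith
  have hΨ₀ : Ψ t₀ y₀ ∈ (extChartAt I x').target :=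
    (extChartAt I x').map_source (hmaps _ hp₀)
  obtain ⟨O₂, hO₂, hΨO₂, -, K', hK', hOK', hK'V⟩ := exists_convex_extChartAt_target_inter x' hΨ₀
  have hΨK : ∀ᶠ p in 𝓝[T ×ˢ (V ∩ O)] (t₀, y₀), Ψ p.1 p.2 ∈ O₂ :=
    (hΨ.continuousOn _ hp₀).eventually (hO₂.mem_nhds hΨO₂)
  refine ⟨{p | p ∈ T ×ˢ (V ∩ O) ∧ Ψ p.1 p.2 ∈ O₂ ∧ ∀ i ∈ Finset.range (k + 1), G i p < D}, ?_, ?_⟩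
  · rw [← hnhds]
    filter_upwards [self_mem_nhdsWithin, hΨK, hGD] with p h1 h2 h3 using ⟨h1, h2, h3⟩
  have hDk : 0 < D ^ k := by positivity
  have hδ : 0 < ε / (2 * k.factorial * D ^ k) := by positivity
  have hev : ∀ᶠ f in 𝓝 (0 : C^∞⟮I, M; ℝ⟯), ∀ i ∈ Finset.range (k + 1), ∀ y ∈ K',
      ‖iteratedFDerivWithin ℝ i (fun z => f ((extChartAt I x').symm z))
          (extChartAt I x').target y‖ < ε / (2 * k.factorial * D ^ k) :=
    (eventually_all_finset _).2 fun i _ => eventually_nhds_zero_smooth x' i hK' hK'V hδ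
  filter_upwards [hev] with f hf
  rintro ⟨t, y⟩ ⟨⟨ht, hy⟩, hpO, hpD⟩
  have hmt : MapsTo (Ψ t) (V ∩ O) (extChartAt I x').target := fun z hz =>
    (extChartAt I x').map_source (hmaps (t, z) ⟨ht, hz⟩)
  have e1 : iteratedFDerivWithin ℝ k
      (fun z => f ((t : UnitAddCircle) +ᵥ (extChartAt I x).symm z)) V y =
      iteratedFDerivWithin ℝ k ((fun z => f ((extChartAt I x').symm z)) ∘ Ψ t) (V ∩ O) y := by
    rw [← iteratedFDerivWithin_inter_open hO hy.2]
    refine iteratedFDerivWithin_congr (fun z hz => ?_) hy k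
    simp only [Function.comp_apply, Ψ]
    rw [(extChartAt I x').left_inv (hmaps (t, z) ⟨ht, hz⟩)]
  have hΨt : ContDiffOn ℝ ∞ (Ψ t) (V ∩ O) :=
    hΨ.comp (f := fun z : E => (t, z)) (by fun_prop) fun z hz => ⟨ht, hz⟩
  have key := norm_iteratedFDerivWithin_comp_le (n := k) (N := ∞)
    (f.contMDiff.contDiffOn_comp_extChartAt_symm x') hΨt (mod_cast le_top)
    (uniqueDiffOn_extChartAt_target x') hU hmt hy
    (C := ε / (2 * k.factorial * D ^ k)) (D := D)
    (fun i hi => (hf i (by simpa [Nat.lt_succ_iff] using hi) _ (hOK' ⟨hmt hy, hpO⟩)).le)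
    (fun i hi1 hi => (hpD i (by simpa [Nat.lt_succ_iff] using hi)).le.trans
      (le_self_pow₀ hD1 (by omega)))
  rw [e1]
  refine key.trans_lt ?_
  have : (k.factorial : ℝ) * (ε / (2 * k.factorial * D ^ k)) * D ^ k = ε / 2 := by
    field_simp
  rw [this]
  exact half_lt_self hε

/-- The operators `f ↦ f ∘ σ_s` are equicontinuous on `C^∞(M)`. -/
theorem eventually_norm_flow_lt [FiniteDimensional ℝ E] (x : M) (k : ℕ) {K : Set E}
    (hK : IsCompact K) (hKV : K ⊆ (extChartAt I x).target) {ε : ℝ} (hε : 0 < ε) :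
    ∀ᶠ f in 𝓝 (0 : C^∞⟮I, M; ℝ⟯), ∀ (s : UnitAddCircle), ∀ y ∈ K,
      ‖iteratedFDerivWithin ℝ k (fun z => f (s +ᵥ (extChartAt I x).symm z))
        (extChartAt I x).target y‖ < ε := by
  have hc : IsCompact (Icc (0 : ℝ) 1 ×ˢ K) := isCompact_Icc.prod hK
  have key : ∀ᶠ f in 𝓝 (0 : C^∞⟮I, M; ℝ⟯), ∀ p ∈ Icc (0 : ℝ) 1 ×ˢ K,
      ‖iteratedFDerivWithin ℝ k
        (fun z => f ((p.1 : UnitAddCircle) +ᵥ (extChartAt I x).symm z))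
        (extChartAt I x).target p.2‖ < ε := by
    refine hc.induction_on (p := fun S => ∀ᶠ f in 𝓝 (0 : C^∞⟮I, M; ℝ⟯), ∀ p ∈ S,
      ‖iteratedFDerivWithin ℝ k
        (fun z => f ((p.1 : UnitAddCircle) +ᵥ (extChartAt I x).symm z))
        (extChartAt I x).target p.2‖ < ε) (by simp) (fun S S' hS h => h.mono fun f hf p hp =>
          hf p (hS hp)) (fun S S' h h' => by
            filter_upwards [h, h'] with f hf hf' p hp using hp.elim (hf p) (hf' p)) ?_
    rintro ⟨t, y⟩ ⟨_, hy⟩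
    obtain ⟨W, hW, h⟩ := exists_nhdsWithin_eventually_norm_flow_lt (I := I) x k hε t (hKV hy)
    exact ⟨W, nhdsWithin_mono _ (prod_mono (subset_univ _) hKV) hW, h⟩
  filter_upwards [key] with f hf s y hy
  obtain ⟨t, ht, rfl⟩ : ∃ t ∈ Icc (0 : ℝ) 1, (t : UnitAddCircle) = s := by
    have : s ∈ ((↑) : ℝ → UnitAddCircle) '' Icc 0 (0 + 1) := by
      rw [AddCircle.coe_image_Icc_eq]
      trivial
    simpa using this
  exact hf (t, y) ⟨ht, hy⟩

variable (I) in
/-- The weighted average `∫ w(s) f(σ_s(x)) dμ(s)` of a function over the circle action. -/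
noncomputable def orbitIntegral (μ : Measure UnitAddCircle) (w : UnitAddCircle → ℝ) (f : M → ℝ)
    (x : M) : ℝ :=
  ∫ s, w s * f (s +ᵥ x) ∂μ

theorem hasFTaylorSeriesUpToOn_orbitIntegral (μ : Measure UnitAddCircle)
    {w : UnitAddCircle → ℝ} (hw : Integrable w μ) (f : C^∞⟮I, M; ℝ⟯) (x : M) {O K : Set E}
    (hO : IsOpen O) (hconv : Convex ℝ ((extChartAt I x).target ∩ O)) (hK : IsCompact K)
    (hOK : (extChartAt I x).target ∩ O ⊆ K) (hKV : K ⊆ (extChartAt I x).target) :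
    HasFTaylorSeriesUpToOn ∞ (fun z => orbitIntegral μ w f ((extChartAt I x).symm z))
      (fun y k => ∫ s, w s • iteratedFDerivWithin ℝ k
        (fun z => f (s +ᵥ (extChartAt I x).symm z)) (extChartAt I x).target y ∂μ)
      ((extChartAt I x).target ∩ O) := by
  set V := (extChartAt I x).target with hVdef
  have hV : UniqueDiffOn ℝ V := uniqueDiffOn_extChartAt_target x
  have hf := contDiffOn_comp_flow f x
  have hs (s : UnitAddCircle) :
      ContDiffOn ℝ ∞ (fun z => f (s +ᵥ (extChartAt I x).symm z)) V := by
    obtain ⟨t, rfl⟩ := QuotientAddGroup.mk_surjective s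
    exact hf.comp (f := fun y : E => (t, y)) (by fun_prop) fun y hy => ⟨mem_univ _, hy⟩
  have hcont (k : ℕ) : ContinuousOn (Function.uncurry fun s : UnitAddCircle =>
      iteratedFDerivWithin ℝ k (fun z => f (s +ᵥ (extChartAt I x).symm z)) V) (univ ×ˢ V) :=
    continuousOn_circle_of_continuousOn_real
      (contDiffOn_iteratedFDerivWithin_slice
        (g := fun (t : ℝ) z => f ((t : UnitAddCircle) +ᵥ (extChartAt I x).symm z))
        hV hf k).continuousOn
  have hbd (k : ℕ) : ∃ C : ℝ, ∀ (s : UnitAddCircle), ∀ y ∈ K,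
      ‖iteratedFDerivWithin ℝ k (fun z => f (s +ᵥ (extChartAt I x).symm z)) V y‖ ≤ C := by
    obtain ⟨C, hC⟩ := ((isCompact_univ (X := UnitAddCircle)).prod hK).exists_bound_of_continuousOn
      ((hcont k).mono (prod_mono_right hKV))
    exact ⟨C, fun s y hy => hC (s, y) ⟨mem_univ _, hy⟩⟩
  choose C hC using hbd
  have hD (k : ℕ) (s : UnitAddCircle) (y : E) (hy : y ∈ V ∩ O) :
      iteratedFDerivWithin ℝ k (fun z => w s * f (s +ᵥ (extChartAt I x).symm z)) (V ∩ O) y =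
      w s • iteratedFDerivWithin ℝ k (fun z => f (s +ᵥ (extChartAt I x).symm z)) V y := by
    rw [iteratedFDerivWithin_inter_open hO hy.2]
    exact iteratedFDerivWithin_const_smul_apply (a := w s)
      (f := fun z => f (s +ᵥ (extChartAt I x).symm z))
      ((hs s y hy.1).of_le (mod_cast le_top)) hV hy.1
  have key := hasFTaylorSeriesUpToOn_integral_of_dominated (μ := μ)
    (f := fun s z => w s * f (s +ᵥ (extChartAt I x).symm z)) hconv (hV.inter hO)
    (fun s => contDiffOn_const.mul ((hs s).mono inter_subset_left))
    (fun k y hy => by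
      simp only [hD k _ y hy]
      exact hw.aestronglyMeasurable.smul
        (continuous_circle_slice (hcont k) hy.1).aestronglyMeasurable)
    (B := fun k s => ‖w s‖ * C k) (fun k => hw.norm.mul_const _)
    (fun k s y hy => by
      rw [hD k s y hy, norm_smul]
      gcongr
      exact hC k s y (hOK hy))
  exact key.congr_series (n := ∞) fun m _ y hy => by simp only [hD m _ y hy]

theorem contMDiff_orbitIntegral [FiniteDimensional ℝ E] (μ : Measure UnitAddCircle)
    {w : UnitAddCircle → ℝ} (hw : Integrable w μ) (f : C^∞⟮I, M; ℝ⟯) :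
    ContMDiff I 𝓘(ℝ, ℝ) ∞ (orbitIntegral μ w f) := by
  refine contMDiff_of_contDiffOn_extChartAt fun x => ?_
  obtain ⟨O, hO, hxO, hconv, K, hK, hOK, hKV⟩ :=
    exists_convex_extChartAt_target_inter (I := I) x (mem_extChartAt_target x)
  exact ⟨O, hO, hxO,
    (hasFTaylorSeriesUpToOn_orbitIntegral μ hw f x hO hconv hK hOK hKV).contDiffOn⟩

theorem iteratedFDerivWithin_orbitIntegral [FiniteDimensional ℝ E] (μ : Measure UnitAddCircle)
    {w : UnitAddCircle → ℝ} (hw : Integrable w μ) (f : C^∞⟮I, M; ℝ⟯) (x : M) (k : ℕ) {y : E}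
    (hy : y ∈ (extChartAt I x).target) :
    iteratedFDerivWithin ℝ k (fun z => orbitIntegral μ w f ((extChartAt I x).symm z))
        (extChartAt I x).target y =
      ∫ s, w s • iteratedFDerivWithin ℝ k
        (fun z => f (s +ᵥ (extChartAt I x).symm z)) (extChartAt I x).target y ∂μ := by
  obtain ⟨O, hO, hyO, hconv, K, hK, hOK, hKV⟩ := exists_convex_extChartAt_target_inter (I := I) x hy
  rw [← iteratedFDerivWithin_inter_open hO hyO]
  exact ((hasFTaylorSeriesUpToOn_orbitIntegral μ hw f x hO hconv hK hOK
    hKV).eq_iteratedFDerivWithin_of_uniqueDiffOn (mod_cast le_top)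
    ((uniqueDiffOn_extChartAt_target x).inter hO) ⟨hy, hyO⟩).symm

omit [IsManifold I ∞ M] in
theorem integrable_mul_orbit {μ : Measure UnitAddCircle} {w : UnitAddCircle → ℝ}
    (hw : Integrable w μ) (f : C^∞⟮I, M; ℝ⟯) (x : M) :
    Integrable (fun s => w s * f (s +ᵥ x)) μ := by
  have hc := continuous_orbit_function I f x
  obtain ⟨C, hC⟩ := isCompact_univ.exists_bound_of_continuousOn hc.continuousOn
  exact hw.mul_bdd hc.aestronglyMeasurable (Eventually.of_forall fun s => hC s (mem_univ s))

variable (I M) in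
/-- The operator `f ↦ ∫ w(s) (f ∘ σ_s) dμ(s)` on `C^∞(M)`. -/
noncomputable def orbitOperator [FiniteDimensional ℝ E] (μ : Measure UnitAddCircle)
    {w : UnitAddCircle → ℝ} (hw : Integrable w μ) : C^∞⟮I, M; ℝ⟯ →ₗ[ℝ] C^∞⟮I, M; ℝ⟯ where
  toFun f := ⟨orbitIntegral μ w f, contMDiff_orbitIntegral μ hw f⟩
  map_add' f g := by
    ext x
    change ∫ s, w s * (f (s +ᵥ x) + g (s +ᵥ x)) ∂μ =
      (∫ s, w s * f (s +ᵥ x) ∂μ) + ∫ s, w s * g (s +ᵥ x) ∂μ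
    simp only [mul_add]
    exact integral_add (integrable_mul_orbit hw f x) (integrable_mul_orbit hw g x)
  map_smul' c f := by
    ext x
    change ∫ s, w s * (c * f (s +ᵥ x)) ∂μ = c * ∫ s, w s * f (s +ᵥ x) ∂μ
    rw [← integral_const_mul]
    congr with s
    ring

theorem orbitOperator_apply [FiniteDimensional ℝ E] (μ : Measure UnitAddCircle)
    {w : UnitAddCircle → ℝ} (hw : Integrable w μ) (f : C^∞⟮I, M; ℝ⟯) (x : M) :
    orbitOperator I M μ hw f x = ∫ s, w s * f (s +ᵥ x) ∂μ := rfl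

theorem continuous_orbitOperator [FiniteDimensional ℝ E] (μ : Measure UnitAddCircle)
    {w : UnitAddCircle → ℝ} (hw : Integrable w μ) : Continuous (orbitOperator I M μ hw) := by
  refine continuous_of_eventually_nhds_zero fun x k K hK hKV ε hε => ?_
  set c : ℝ := ∫ s, ‖w s‖ ∂μ with hc
  have hc0 : 0 ≤ c := integral_nonneg fun s => norm_nonneg _
  filter_upwards [eventually_norm_flow_lt (I := I) x k hK hKV (ε := ε / (c + 1)) (by positivity)]
    with f hf y hy
  have e1 := iteratedFDerivWithin_orbitIntegral μ hw f x k (hKV hy)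
  change ‖iteratedFDerivWithin ℝ k (fun z => orbitIntegral μ w f ((extChartAt I x).symm z))
    (extChartAt I x).target y‖ < ε
  rw [e1]
  calc _ ≤ ∫ s, ‖w s‖ * (ε / (c + 1)) ∂μ := by
        refine norm_integral_le_of_norm_le (hw.norm.mul_const _) (Eventually.of_forall fun s => ?_)
        rw [norm_smul]
        gcongr
        exact (hf s y hy).le
    _ = c * (ε / (c + 1)) := by rw [integral_mul_const]
    _ < ε := by
        rw [← mul_div_assoc, div_lt_iff₀ (by positivity)]
        nlinarith

theorem arcOperator_eq_orbitOperator [FiniteDimensional ℝ E] (A : Set UnitAddCircle) :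
    arcOperator I (M := M) A = orbitOperator I M (volume.restrict A) (integrable_const 1) := by
  ext f x
  rw [orbitOperator_apply]
  simp only [one_mul]
  rfl

end Action

/-! ### The generator of the action -/

section Generator

open Set Filter MeasureTheory

variable {E : Type*} [NormedAddCommGroup E] [NormedSpace ℝ E]
  {H : Type*} [TopologicalSpace H] {I : ModelWithCorners ℝ E H}
  {M : Type*} [TopologicalSpace M] [ChartedSpace H M] [IsManifold I ∞ M]
  [AddAction UnitAddCircle M] [SmoothCircleAction I M]

/-- The derivative of a function along the flow of the circle action. -/
noncomputable def flowDeriv (f : M → ℝ) (x : M) : ℝ :=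
  deriv (fun t : ℝ => f ((t : UnitAddCircle) +ᵥ x)) 0

theorem hasDerivAt_fderivWithin_prod_left {F : Type*} [NormedAddCommGroup F] [NormedSpace ℝ F]
    {Φ : ℝ × E → F} {S : Set (ℝ × E)} {t : ℝ} {y : E} (hΦ : DifferentiableWithinAt ℝ Φ S (t, y))
    (hS : ∀ᶠ s in 𝓝 t, (s, y) ∈ S) :
    HasDerivAt (fun s => Φ (s, y)) (fderivWithin ℝ Φ S (t, y) (1, 0)) t := by
  have h2 : HasDerivWithinAt (fun s : ℝ => (s, y)) ((1, 0) : ℝ × E) {s | (s, y) ∈ S} t :=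
    ((hasDerivAt_id t).prodMk (hasDerivAt_const t y)).hasDerivWithinAt
  exact (hΦ.hasFDerivWithinAt.comp_hasDerivWithinAt t h2 fun s hs => hs).hasDerivAt hS

theorem contMDiff_flowDeriv (f : C^∞⟮I, M; ℝ⟯) : ContMDiff I 𝓘(ℝ, ℝ) ∞ (flowDeriv f) := by
  refine contMDiff_of_contDiffOn_extChartAt fun x => ⟨univ, isOpen_univ, mem_univ _, ?_⟩
  rw [inter_univ]
  have hf := contDiffOn_comp_flow f x
  have hS : UniqueDiffOn ℝ ((univ : Set ℝ) ×ˢ (extChartAt I x).target) :=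
    uniqueDiffOn_univ.prod (uniqueDiffOn_extChartAt_target x)
  have h1 := (hf.fderivWithin (m := ∞) hS (by simp)).comp (s := (extChartAt I x).target)
    (f := fun y : E => ((0 : ℝ), y)) (by fun_prop) fun y hy => ⟨mem_univ _, hy⟩
  refine (h1.clm_apply (contDiffOn_const (c := ((1, 0) : ℝ × E)))).congr fun y hy => ?_
  exact (hasDerivAt_fderivWithin_prod_left
    (hf.differentiableOn (by simp) _ ⟨mem_univ 0, hy⟩)
    (Eventually.of_forall fun s => ⟨mem_univ _, hy⟩)).deriv

/-- In a chart, the derivative along the flow is the derivative in the direction of a smooth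
vector field. -/
theorem exists_vectorField_flowDeriv (x : M) : ∃ v : E → E,
    ContDiffOn ℝ ∞ v (extChartAt I x).target ∧
    ∀ f : C^∞⟮I, M; ℝ⟯, ∀ y ∈ (extChartAt I x).target,
      flowDeriv f ((extChartAt I x).symm y) =
        fderivWithin ℝ (fun z => f ((extChartAt I x).symm z)) (extChartAt I x).target y (v y) := by
  set V := (extChartAt I x).target with hV
  have hflow := contMDiffOn_flow_extChartAt_symm I x
  obtain ⟨O, hO, hOe⟩ := continuousOn_iff'.1 hflow.continuousOn _
    (isOpen_extChartAt_source (I := I) x)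
  let Ψ : ℝ × E → E := fun p => extChartAt I x ((p.1 : UnitAddCircle) +ᵥ (extChartAt I x).symm p.2)
  let S : Set (ℝ × E) := (univ ×ˢ V) ∩ O
  have hSsrc : ∀ p ∈ S,
      (p.1 : UnitAddCircle) +ᵥ (extChartAt I x).symm p.2 ∈ (extChartAt I x).source := by
    intro p hp
    have : p ∈ O ∩ univ ×ˢ V := ⟨hp.2, hp.1⟩
    rw [← hOe] at this
    exact this.1
  have hmem0 : ∀ y ∈ V, ((0 : ℝ), y) ∈ O := by
    intro y hy
    have h1 : ((0 : ℝ), y) ∈ (fun p : ℝ × E => (p.1 : UnitAddCircle) +ᵥ (extChartAt I x).symm p.2)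
        ⁻¹' (extChartAt I x).source ∩ univ ×ˢ V := by
      refine ⟨?_, mem_univ _, hy⟩
      simpa using (extChartAt I x).map_target hy
    rw [hOe] at h1
    exact h1.1
  have hS : UniqueDiffOn ℝ S :=
    (uniqueDiffOn_univ.prod (uniqueDiffOn_extChartAt_target x)).inter hO
  have hΨ : ContDiffOn ℝ ∞ Ψ S :=
    contMDiffOn_iff_contDiffOn.1 ((contMDiffOn_extChartAt (x := x)).comp
      (hflow.mono fun p hp => hp.1) fun p hp => by simpa using hSsrc p hp)
  have h1 := (hΨ.fderivWithin (m := ∞) hS (by simp)).comp (s := V)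
    (f := fun y : E => ((0 : ℝ), y)) (by fun_prop) fun y hy => ⟨⟨mem_univ _, hy⟩, hmem0 y hy⟩
  refine ⟨_, h1.clm_apply (contDiffOn_const (c := ((1, 0) : ℝ × E))), fun f y hy => ?_⟩
  have hev : ∀ᶠ s : ℝ in 𝓝 0, (s, y) ∈ S := by
    have : ∀ᶠ s : ℝ in 𝓝 0, (s, y) ∈ O :=
      (Continuous.prodMk_left y).continuousAt.eventually (hO.mem_nhds (hmem0 y hy))
    filter_upwards [this] with s hs using ⟨⟨mem_univ _, hy⟩, hs⟩
  have hd := hasDerivAt_fderivWithin_prod_left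
    (hΨ.differentiableOn (by simp) (0, y) ⟨⟨mem_univ 0, hy⟩, hmem0 y hy⟩) hev
  have hΨ0 : Ψ (0, y) = y := by
    change extChartAt I x (((0 : ℝ) : UnitAddCircle) +ᵥ (extChartAt I x).symm y) = y
    rw [AddCircle.coe_zero, zero_vadd, (extChartAt I x).right_inv hy]
  have hfd : HasFDerivWithinAt (fun z => f ((extChartAt I x).symm z))
      (fderivWithin ℝ (fun z => f ((extChartAt I x).symm z)) V y) V (Ψ (0, y)) := by
    rw [hΨ0]
    exact ((f.contMDiff.contDiffOn_comp_extChartAt_symm x).differentiableOn (by simp) y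
      hy).hasFDerivWithinAt
  have hcomp := (hfd.comp_hasDerivWithinAt (s := {s | (s, y) ∈ S}) 0 hd.hasDerivWithinAt
    fun s hs => (extChartAt I x).map_source (hSsrc _ hs)).hasDerivAt hev
  refine (hcomp.congr_of_eventuallyEq ?_).deriv
  filter_upwards [hev] with s hs
  simp only [Function.comp_apply, Ψ]
  rw [(extChartAt I x).left_inv (hSsrc _ hs)]

variable (I) in
/-- The generator of the circle action, as an operator on `C^∞(M)`. -/
noncomputable def generator : C^∞⟮I, M; ℝ⟯ →ₗ[ℝ] C^∞⟮I, M; ℝ⟯ where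
  toFun f := ⟨flowDeriv f, contMDiff_flowDeriv f⟩
  map_add' f g := by
    ext x
    have hy := mem_extChartAt_target (I := I) x
    obtain ⟨v, -, hv⟩ := exists_vectorField_flowDeriv (I := I) x
    have hd (f : C^∞⟮I, M; ℝ⟯) := (f.contMDiff.contDiffOn_comp_extChartAt_symm x).differentiableOn
      (by simp) _ hy
    have h (f : C^∞⟮I, M; ℝ⟯) := hv f _ hy
    rw [extChartAt_to_inv] at h
    change flowDeriv (f + g) x = flowDeriv f x + flowDeriv g x
    rw [h f, h g, ← _root_.add_apply,
      ← fderivWithin_add (uniqueDiffOn_extChartAt_target x _ hy) (hd f) (hd g)]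
    exact h (f + g)
  map_smul' c f := by
    ext x
    exact deriv_const_mul_field c

theorem continuous_generator : Continuous (generator I (M := M)) := by
  refine continuous_of_eventually_nhds_zero fun x k K hK hKV ε hε => ?_
  obtain ⟨v, hvs, hv⟩ := exists_vectorField_flowDeriv (I := I) x
  set V := (extChartAt I x).target with hVdef
  have hV : UniqueDiffOn ℝ V := uniqueDiffOn_extChartAt_target x
  have hbd (i : ℕ) : ∃ C : ℝ, 0 ≤ C ∧ ∀ y ∈ K, ‖iteratedFDerivWithin ℝ i v V y‖ ≤ C := by
    obtain ⟨C, hC⟩ := hK.exists_bound_of_continuousOn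
      ((hvs.continuousOn_iteratedFDerivWithin (m := i) (mod_cast le_top) hV).mono hKV)
    exact ⟨max C 0, le_max_right _ _, fun y hy => (hC y hy).trans (le_max_left _ _)⟩
  choose C hC0 hC using hbd
  set S : ℝ := ∑ i ∈ Finset.range (k + 1), (k.choose i : ℝ) * C (k - i) with hS
  have hS0 : 0 ≤ S := Finset.sum_nonneg fun i _ => mul_nonneg (Nat.cast_nonneg _) (hC0 _)
  have hδ : 0 < ε / (S + 1) := by positivity
  have hev : ∀ᶠ f in 𝓝 (0 : C^∞⟮I, M; ℝ⟯), ∀ i ∈ Finset.range (k + 1), ∀ y ∈ K,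
      ‖iteratedFDerivWithin ℝ (i + 1) (fun z => f ((extChartAt I x).symm z)) V y‖ <
        ε / (S + 1) :=
    (eventually_all_finset _).2 fun i _ => eventually_nhds_zero_smooth x (i + 1) hK hKV hδ
  filter_upwards [hev] with f hf y hy
  have hyV := hKV hy
  have hfs := f.contMDiff.contDiffOn_comp_extChartAt_symm x
  have e1 : iteratedFDerivWithin ℝ k (fun z => generator I f ((extChartAt I x).symm z)) V y =
      iteratedFDerivWithin ℝ k (fun y =>
        fderivWithin ℝ (fun z => f ((extChartAt I x).symm z)) V y (v y)) V y :=
    iteratedFDerivWithin_congr (fun z hz => hv f z hz) hyV k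
  rw [e1]
  refine (norm_iteratedFDerivWithin_clm_apply (N := ∞) (hfs.fderivWithin hV (by simp)) hvs hV hyV
    (mod_cast le_top)).trans_lt ?_
  calc _ ≤ ∑ i ∈ Finset.range (k + 1), (k.choose i : ℝ) * (ε / (S + 1)) * C (k - i) := by
        refine Finset.sum_le_sum fun i hi => ?_
        rw [norm_iteratedFDerivWithin_fderivWithin hV hyV]
        gcongr
        · exact (hf i hi y hy).le
        · exact hC _ y hy
    _ = S * (ε / (S + 1)) := by
        rw [hS, Finset.sum_mul]
        exact Finset.sum_congr rfl fun i _ => by ring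
    _ < ε := by
        rw [← mul_div_assoc, div_lt_iff₀ (by positivity)]
        nlinarith

/-- Along each orbit the generator acts as the derivative in the time variable. -/
theorem hasDerivAt_orbit (f : C^∞⟮I, M; ℝ⟯) (x : M) (t : ℝ) :
    HasDerivAt (fun s : ℝ => f ((s : UnitAddCircle) +ᵥ x))
      (generator I f ((t : UnitAddCircle) +ᵥ x)) t := by
  have hd (y : M) : DifferentiableAt ℝ (fun s : ℝ => f ((s : UnitAddCircle) +ᵥ y)) 0 := by
    have hy := mem_extChartAt_target (I := I) y
    have := hasDerivAt_fderivWithin_prod_left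
      ((contDiffOn_comp_flow f y).differentiableOn (by simp) (0, extChartAt I y y)
        ⟨mem_univ _, hy⟩) (Eventually.of_forall fun s => ⟨mem_univ _, hy⟩)
    simpa using this.differentiableAt
  have h0 : HasDerivAt (fun s : ℝ => f ((s : UnitAddCircle) +ᵥ ((t : UnitAddCircle) +ᵥ x)))
      (generator I f ((t : UnitAddCircle) +ᵥ x)) (t - t) := by
    rw [sub_self]
    exact (hd _).hasDerivAt
  have h1 := h0.comp_sub_const t t
  refine h1.congr_of_eventuallyEq (Eventually.of_forall fun s => ?_)
  simp [vadd_vadd]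

end Generator

/-! ### Fourier series on the circle -/

section CircleFourier

open Set Filter MeasureTheory

theorem norm_fourier_apply (n : ℤ) (s : UnitAddCircle) : ‖(fourier n s : ℂ)‖ = 1 :=
  Circle.norm_coe _

theorem fourierCoeff_eq_integral_volume (φ : UnitAddCircle → ℂ) (n : ℤ) :
    fourierCoeff φ n = ∫ s : UnitAddCircle, fourier (-n) s * φ s := by
  rw [fourierCoeff, AddCircle.integral_haarAddCircle]
  simp

/-- A continuous function on the circle without oscillating Fourier modes is constant. -/
theorem ContinuousMap.eq_fourierCoeff_zero (φ : C(UnitAddCircle, ℂ))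
    (h : ∀ n : ℤ, n ≠ 0 → fourierCoeff φ n = 0) (s : UnitAddCircle) : φ s = fourierCoeff φ 0 := by
  have hs : Summable (fourierCoeff φ) := summable_of_ne_finset_zero (s := {0}) fun n hn =>
    h n (by simpa using hn)
  have h1 := has_pointwise_sum_fourier_series_of_summable hs s
  have h2 : HasSum (fun n : ℤ => fourierCoeff φ n • fourier n s)
      (fourierCoeff φ 0 • fourier 0 s) :=
    hasSum_single 0 fun n hn => by rw [h n hn, zero_smul]
  simpa using h1.unique h2

theorem integral_fourier_volume (n : ℤ) :
    ∫ s : UnitAddCircle, (fourier n s : ℂ) = if n = 0 then 1 else 0 := by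
  have h := congrFun (fourierCoeff_fourier (T := 1) n) 0
  rw [fourierCoeff_eq_integral_volume] at h
  simp only [neg_zero, fourier_zero, one_mul] at h
  rw [h, Pi.single_apply]
  simp [eq_comm]

/-- A real continuous function on the circle with prescribed absolutely summable Fourier
coefficients. -/
theorem exists_integral_mul_fourier_eq {b : ℤ → ℂ} (hb : Summable fun n => ‖b n‖)
    (hconj : ∀ n, b (-n) = starRingEnd ℂ (b n)) :
    ∃ h : C(UnitAddCircle, ℝ), ∀ n : ℤ, ∫ r : UnitAddCircle, (h r : ℂ) * fourier n r = b n := by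
  let F : ℤ → C(UnitAddCircle, ℂ) := fun n => b n • fourier (-n)
  have hF : Summable F := by
    refine Summable.of_norm (hb.congr fun n => ?_)
    simp only [F]
    rw [norm_smul, fourier_norm, mul_one]
  let G : C(UnitAddCircle, ℂ) := ∑' n, F n
  have hG (n : ℤ) : ∫ r : UnitAddCircle, G r * fourier n r = b n := by
    have hcont (m : ℤ) : Continuous fun r : UnitAddCircle => F m r * fourier n r := by fun_prop
    have h1 : HasSum (fun m => ∫ r : UnitAddCircle, F m r * fourier n r)
        (∫ r : UnitAddCircle, ∑' m, F m r * fourier n r) := by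
      refine hasSum_integral_of_summable_integral_norm
        (fun m => integrable_of_continuous_circle (hcont m) univ |>.mono_measure (by simp)) ?_
      refine hb.congr fun m => ?_
      simp only [F, ContinuousMap.smul_apply, norm_smul, norm_mul, norm_fourier_apply, mul_one]
      simp [measureReal_def]
    have h2 (r : UnitAddCircle) : ∑' m, F m r * fourier n r = G r * fourier n r := by
      rw [tsum_mul_right]
      congr 1
      exact ContinuousMap.tsum_apply hF r
    have h3 (m : ℤ) : ∫ r : UnitAddCircle, F m r * fourier n r = if m = n then b n else 0 := by
      have e (r : UnitAddCircle) : F m r * fourier n r = b m * fourier (-m + n) r := by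
        rw [fourier_add]
        simp only [F, ContinuousMap.smul_apply, smul_eq_mul, mul_assoc]
      simp only [e]
      rw [integral_const_mul, integral_fourier_volume]
      by_cases hmn : m = n
      · simp [hmn]
      · rw [if_neg (by omega), if_neg hmn, mul_zero]
    simp only [h2, h3] at h1
    exact h1.unique (hasSum_ite_eq n (b n))
  refine ⟨⟨fun r => (G r).re, by fun_prop⟩, fun n => ?_⟩
  have hint (H : UnitAddCircle → ℂ) (hH : Continuous H) : Integrable H volume := by
    simpa using integrable_of_continuous_circle hH univ
  have e (r : UnitAddCircle) : ((G r).re : ℂ) * fourier n r =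
      (G r * fourier n r + starRingEnd ℂ (G r * fourier (-n) r)) / 2 := by
    rw [Complex.re_eq_add_conj, map_mul, fourier_neg, Complex.conj_conj]
    ring
  have hi1 : Integrable (fun r : UnitAddCircle => G r * fourier n r) := hint _ (by fun_prop)
  have hi2 : Integrable (fun r : UnitAddCircle => starRingEnd ℂ (G r * fourier (-n) r)) :=
    hint _ (Complex.continuous_conj.comp (by fun_prop))
  simp only [ContinuousMap.coe_mk, e]
  rw [integral_div, integral_add hi1 hi2, integral_conj, hG, hG, hconj, Complex.conj_conj]
  ring

end CircleFourier

/-! ### Fourier coefficients along orbits -/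

section OrbitFourier

open Set Filter MeasureTheory

variable {E : Type*} [NormedAddCommGroup E] [NormedSpace ℝ E]
  {H : Type*} [TopologicalSpace H] {I : ModelWithCorners ℝ E H}
  {M : Type*} [TopologicalSpace M] [ChartedSpace H M]
  [AddAction UnitAddCircle M]

/-- The `n`-th Fourier coefficient of the function `s ↦ f (σ_s p)` on the circle. -/
noncomputable def orbitCoeff (f : M → ℝ) (p : M) (n : ℤ) : ℂ :=
  ∫ s : UnitAddCircle, fourier (-n) s * (f (s +ᵥ p) : ℂ)

variable [SmoothCircleAction I M]

theorem continuous_orbit_ofReal (f : C^∞⟮I, M; ℝ⟯) (p : M) :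
    Continuous fun s : UnitAddCircle => (f (s +ᵥ p) : ℂ) :=
  Complex.continuous_ofReal.comp (continuous_orbit_function I f p)

theorem integrable_fourier_mul_orbit (f : C^∞⟮I, M; ℝ⟯) (p : M) (n : ℤ) :
    Integrable (fun s : UnitAddCircle => fourier n s * (f (s +ᵥ p) : ℂ)) := by
  have h : Continuous fun s : UnitAddCircle => fourier n s * (f (s +ᵥ p) : ℂ) :=
    (fourier n).continuous.mul (continuous_orbit_ofReal f p)
  have := integrable_of_continuous_circle h univ
  rwa [Measure.restrict_univ] at this

theorem orbitCoeff_add (f g : C^∞⟮I, M; ℝ⟯) (p : M) (n : ℤ) :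
    orbitCoeff (f + g : C^∞⟮I, M; ℝ⟯) p n = orbitCoeff f p n + orbitCoeff g p n := by
  rw [orbitCoeff, orbitCoeff, orbitCoeff, ← integral_add (integrable_fourier_mul_orbit f p (-n))
    (integrable_fourier_mul_orbit g p (-n))]
  congr with s
  simp [mul_add]

omit [SmoothCircleAction I M] in
theorem orbitCoeff_smul (c : ℝ) (f : C^∞⟮I, M; ℝ⟯) (p : M) (n : ℤ) :
    orbitCoeff (c • f : C^∞⟮I, M; ℝ⟯) p n = c * orbitCoeff f p n := by
  rw [orbitCoeff, orbitCoeff, ← integral_const_mul]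
  congr with s
  simp
  ring

theorem orbit_constant_of_orbitCoeff_eq_zero {f : C^∞⟮I, M; ℝ⟯} {p : M}
    (h : ∀ n : ℤ, n ≠ 0 → orbitCoeff f p n = 0) (s : UnitAddCircle) :
    (f (s +ᵥ p) : ℂ) = orbitCoeff f p 0 := by
  have := ContinuousMap.eq_fourierCoeff_zero ⟨_, continuous_orbit_ofReal f p⟩
    (fun n hn => (fourierCoeff_eq_integral_volume _ n).trans (h n hn)) s
  exact this.trans (fourierCoeff_eq_integral_volume _ 0)

/-- A smooth function is determined by its Fourier coefficients along the orbits. -/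
theorem eq_of_orbitCoeff_eq {f g : C^∞⟮I, M; ℝ⟯}
    (h : ∀ p n, orbitCoeff f p n = orbitCoeff g p n) : f = g := by
  ext p
  have h0 (n : ℤ) : orbitCoeff (f + (-1 : ℝ) • g : C^∞⟮I, M; ℝ⟯) p n = 0 := by
    rw [orbitCoeff_add, orbitCoeff_smul, h]
    simp
  have := orbit_constant_of_orbitCoeff_eq_zero (fun n _ => h0 n) (0 : UnitAddCircle)
  rw [h0, zero_vadd, Complex.ofReal_eq_zero] at this
  have h1 : f p + (-1 : ℝ) * g p = 0 := this
  linarith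

omit [SmoothCircleAction I M] in
theorem norm_orbitCoeff_le (f : C^∞⟮I, M; ℝ⟯) (p : M) :
    ∃ C : ℝ, ∀ n, ‖orbitCoeff f p n‖ ≤ C := by
  refine ⟨∫ s : UnitAddCircle, ‖f (s +ᵥ p)‖, fun n => ?_⟩
  refine (norm_integral_le_integral_norm _).trans_eq (integral_congr_ae ?_)
  refine Eventually.of_forall fun s => ?_
  simp only [norm_mul, norm_fourier_apply, one_mul, Complex.norm_real]

/-- Weighted averages are convolutions along the orbits, hence Fourier multipliers. -/
theorem orbitCoeff_orbitOperator [FiniteDimensional ℝ E] [IsManifold I ∞ M]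
    (μ : Measure UnitAddCircle) [SFinite μ]
    {w : UnitAddCircle → ℝ} (hw : Integrable w μ) (f : C^∞⟮I, M; ℝ⟯) (p : M) (n : ℤ) :
    orbitCoeff (orbitOperator I M μ hw f) p n =
      (∫ r, (w r : ℂ) * fourier n r ∂μ) * orbitCoeff f p n := by
  have hcont : Continuous fun q : UnitAddCircle × UnitAddCircle =>
      fourier (-n) q.1 * (f ((q.2 + q.1) +ᵥ p) : ℂ) :=
    ((fourier (-n)).continuous.comp continuous_fst).mul
      ((continuous_orbit_ofReal f p).comp (continuous_snd.add continuous_fst))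
  have hint : Integrable (Function.uncurry fun (s r : UnitAddCircle) =>
      (w r : ℂ) * (fourier (-n) s * (f ((r + s) +ᵥ p) : ℂ))) (volume.prod μ) := by
    have hw' : Integrable (fun r => (w r : ℂ)) μ := hw.ofReal
    have h1 : Integrable (fun q : UnitAddCircle × UnitAddCircle => (w q.2 : ℂ))
        ((volume : Measure UnitAddCircle).prod μ) := hw'.comp_snd volume
    obtain ⟨C, hC⟩ := isCompact_univ.exists_bound_of_continuousOn hcont.continuousOn
    exact h1.mul_bdd hcont.aestronglyMeasurable
      (Eventually.of_forall fun q => hC q (mem_univ q))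
  calc orbitCoeff (orbitOperator I M μ hw f) p n
      = ∫ s : UnitAddCircle, ∫ r, (w r : ℂ) * (fourier (-n) s * (f ((r + s) +ᵥ p) : ℂ)) ∂μ := by
        rw [orbitCoeff]
        congr with s
        rw [orbitOperator_apply, ← integral_complex_ofReal, ← integral_const_mul]
        congr with r
        rw [vadd_vadd]
        push_cast
        ring
    _ = ∫ r, ∫ s : UnitAddCircle,
          (w r : ℂ) * (fourier (-n) s * (f ((r + s) +ᵥ p) : ℂ)) ∂volume ∂μ :=
        integral_integral_swap hint
    _ = ∫ r, ((w r : ℂ) * fourier n r) * orbitCoeff f p n ∂μ := by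
        congr with r
        rw [integral_const_mul, mul_assoc]
        congr 1
        rw [orbitCoeff, ← integral_const_mul, ← integral_add_left_eq_self
          (fun s : UnitAddCircle => fourier n r * (fourier (-n) s * (f (s +ᵥ p) : ℂ))) r]
        congr with s
        have : (fourier (-n) (r + s) : ℂ) = fourier (-n) r * fourier (-n) s := by
          simp [smul_add, AddCircle.toCircle_add]
        rw [this, ← mul_assoc, ← mul_assoc, ← fourier_add]
        simp
    _ = _ := integral_mul_const _ _

theorem orbitCoeff_generator [IsManifold I ∞ M] (f : C^∞⟮I, M; ℝ⟯) (p : M) (n : ℤ) :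
    orbitCoeff (generator I f) p n = (2 * Real.pi * Complex.I * n) * orbitCoeff f p n := by
  have hd (t : ℝ) : HasDerivAt
      (fun t : ℝ => (fourier (-n) (t : UnitAddCircle) : ℂ) * (f ((t : UnitAddCircle) +ᵥ p) : ℂ))
      (-2 * Real.pi * Complex.I * n / (1 : ℝ) * fourier (-n) (t : UnitAddCircle) *
        (f ((t : UnitAddCircle) +ᵥ p) : ℂ) + fourier (-n) (t : UnitAddCircle) *
        (generator I f ((t : UnitAddCircle) +ᵥ p) : ℂ)) t :=
    (hasDerivAt_fourier_neg 1 n t).mul (hasDerivAt_orbit f p t).ofReal_comp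
  have hc1 : Continuous fun s : UnitAddCircle =>
      -2 * Real.pi * Complex.I * n / (1 : ℝ) * fourier (-n) s * (f (s +ᵥ p) : ℂ) :=
    (continuous_const.mul (fourier (-n)).continuous).mul (continuous_orbit_ofReal f p)
  have hc2 : Continuous fun s : UnitAddCircle =>
      fourier (-n) s * (generator I f (s +ᵥ p) : ℂ) :=
    (fourier (-n)).continuous.mul (continuous_orbit_ofReal (generator I f) p)
  have hcoe : Continuous ((↑) : ℝ → UnitAddCircle) := AddCircle.continuous_mk' 1
  have h0 := intervalIntegral.integral_eq_sub_of_hasDerivAt (a := 0) (b := 1)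
    (fun t _ => hd t) (((hc1.comp hcoe).add (hc2.comp hcoe)).intervalIntegrable 0 1)
  have hper : ((1 : ℝ) : UnitAddCircle) = ((0 : ℝ) : UnitAddCircle) := by
    rw [AddCircle.coe_zero]
    exact AddCircle.coe_period 1
  rw [hper, sub_self, intervalIntegral.integral_of_le zero_le_one] at h0
  have h1 := UnitAddCircle.integral_preimage 0 (fun s : UnitAddCircle =>
    -2 * Real.pi * Complex.I * n / (1 : ℝ) * fourier (-n) s * (f (s +ᵥ p) : ℂ) +
      fourier (-n) s * (generator I f (s +ᵥ p) : ℂ))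
  rw [zero_add, h0] at h1
  have hi1 : Integrable (fun s : UnitAddCircle =>
      -2 * Real.pi * Complex.I * n / (1 : ℝ) * fourier (-n) s * (f (s +ᵥ p) : ℂ)) := by
    simpa using integrable_of_continuous_circle hc1 univ
  rw [integral_add hi1 (integrable_fourier_mul_orbit (generator I f) p (-n))] at h1
  simp only [mul_assoc] at h1
  simp only [← mul_assoc, Complex.ofReal_one, div_one] at h1
  have h2 : orbitCoeff (generator I f) p n =
      - ∫ s : UnitAddCircle, -2 * Real.pi * Complex.I * n * fourier (-n) s * (f (s +ᵥ p) : ℂ) :=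
    eq_neg_of_add_eq_zero_right h1.symm
  rw [h2, orbitCoeff, ← integral_const_mul, ← integral_neg]
  congr with s
  ring

theorem orbitCoeff_generator_pow [IsManifold I ∞ M] (f : C^∞⟮I, M; ℝ⟯) (p : M) (n : ℤ) (k : ℕ) :
    orbitCoeff ((generator I ^ k) f) p n =
      (2 * Real.pi * Complex.I * n) ^ k * orbitCoeff f p n := by
  induction k with
  | zero => simp
  | succ k ih =>
    rw [pow_succ', Module.End.mul_apply, orbitCoeff_generator, ih]
    ring

end OrbitFourier

/-! ### Integrals over arcs -/

section Arcs

open Set Filter MeasureTheory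

theorem volume_singleton_unitAddCircle (s : UnitAddCircle) :
    volume ({s} : Set UnitAddCircle) = 0 := by
  have := AddCircle.volume_closedBall 1 (x := s) 0
  simpa using this

/-- An arc need not be measurable as a set, but it differs from an open arc by a null set. -/
theorem IsArcOfLength.exists_setIntegral_eq {A : Set UnitAddCircle} {ℓ : ℝ}
    (hA : IsArcOfLength A ℓ) : ∃ a : ℝ, ∀ g : UnitAddCircle → ℂ,
      ∫ s in A, g s = ∫ t in a..(a + ℓ), g (t : UnitAddCircle) := by
  obtain ⟨h0, h1, a, hsub, hsup⟩ := hA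
  refine ⟨a, fun g => ?_⟩
  set J : Set UnitAddCircle := ((↑) : ℝ → UnitAddCircle) '' Ioo a (a + ℓ) with hJ
  have hJm : MeasurableSet J :=
    (QuotientAddGroup.isOpenQuotientMap_mk.isOpenMap _ isOpen_Ioo).measurableSet
  have hAJ : A =ᵐ[volume] J := by
    have hd : A \ J ⊆ {(a : UnitAddCircle)} ∪ {((a + ℓ : ℝ) : UnitAddCircle)} := by
      rintro s ⟨hsA, hsJ⟩
      obtain ⟨t, ht, rfl⟩ := hsup hsA
      by_cases hta : t = a
      · exact Or.inl (by rw [hta]; rfl)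
      by_cases htb : t = a + ℓ
      · exact Or.inr (by rw [htb]; rfl)
      exact absurd ⟨t, ⟨lt_of_le_of_ne ht.1 (Ne.symm hta), lt_of_le_of_ne ht.2 htb⟩, rfl⟩ hsJ
    refine Filter.EventuallyLE.antisymm ?_ (LE.le.eventuallyLE hsub)
    refine ae_le_set.2 (measure_mono_null hd (measure_union_null ?_ ?_)) <;>
      exact volume_singleton_unitAddCircle _
  rw [setIntegral_congr_set hAJ, ← integral_indicator hJm,
    ← UnitAddCircle.integral_preimage a (J.indicator g),
    intervalIntegral.integral_of_le (by linarith),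
    integral_Ioc_eq_integral_Ioo (x := a) (y := a + ℓ)]
  have hind : EqOn (fun t : ℝ => J.indicator g (t : UnitAddCircle))
      ((Ioo a (a + ℓ)).indicator fun t : ℝ => g (t : UnitAddCircle)) (Ioc a (a + 1)) := by
    intro t ht
    have hiff : (t : UnitAddCircle) ∈ J ↔ t ∈ Ioo a (a + ℓ) := by
      refine ⟨?_, fun h => ⟨t, h, rfl⟩⟩
      rintro ⟨t', ht', heq⟩
      have : t' = t := (AddCircle.coe_eq_coe_iff_of_mem_Ioc ⟨ht'.1, by linarith [ht'.2]⟩ ht).1 heq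
      rwa [← this]
    by_cases h : t ∈ Ioo a (a + ℓ)
    · simp only [indicator_of_mem h, indicator_of_mem (hiff.2 h)]
    · simp only [indicator_of_notMem h, indicator_of_notMem (mt hiff.1 h)]
  have hsub' : Ioo a (a + ℓ) ⊆ Ioc a (a + 1) := fun t ht => ⟨ht.1, by linarith [ht.2]⟩
  rw [setIntegral_congr_fun measurableSet_Ioc hind, setIntegral_indicator measurableSet_Ioo,
    inter_eq_self_of_subset_right hsub']

end Arcs

/-! ### Fourier coefficients of arcs and Diophantine approximation -/

section ArcCoefficients

open Set Filter MeasureTheory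

/-- The Fourier coefficient `∫_A e^{2πinr} dr` of a subset of the circle. -/
noncomputable def arcCoeff (A : Set UnitAddCircle) (n : ℤ) : ℂ :=
  ∫ r in A, (fourier n r : ℂ)

theorem arcCoeff_neg (A : Set UnitAddCircle) (n : ℤ) :
    arcCoeff A (-n) = starRingEnd ℂ (arcCoeff A n) := by
  rw [arcCoeff, arcCoeff, ← integral_conj]
  simp only [fourier_neg]

theorem IsArcOfLength.arcCoeff_zero {A : Set UnitAddCircle} {ℓ : ℝ} (hA : IsArcOfLength A ℓ) :
    arcCoeff A 0 = ℓ := by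
  obtain ⟨a, ha⟩ := hA.exists_setIntegral_eq
  rw [arcCoeff, ha]
  simp

theorem IsArcOfLength.norm_arcCoeff {A : Set UnitAddCircle} {ℓ : ℝ} (hA : IsArcOfLength A ℓ)
    {n : ℤ} (hn : n ≠ 0) :
    ‖arcCoeff A n‖ = |Real.sin (Real.pi * (n * ℓ))| / (Real.pi * |(n : ℝ)|) := by
  obtain ⟨a, ha⟩ := hA.exists_setIntegral_eq
  have hc : (2 * Real.pi * Complex.I * n : ℂ) ≠ 0 := by
    simp [Real.pi_ne_zero, hn]
  have e (t : ℝ) : (fourier n (t : UnitAddCircle) : ℂ) =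
      Complex.exp (2 * Real.pi * Complex.I * n * t) := by
    rw [fourier_coe_apply]
    simp
  rw [arcCoeff, ha]
  simp only [e]
  rw [integral_exp_mul_complex hc]
  have e2 : Complex.exp (2 * Real.pi * Complex.I * n * (a + ℓ : ℝ)) -
      Complex.exp (2 * Real.pi * Complex.I * n * a) =
      Complex.exp ((2 * Real.pi * n * a : ℝ) * Complex.I) *
        (Complex.exp (Complex.I * (2 * (Real.pi * (n * ℓ)) : ℝ)) - 1) := by
    rw [mul_sub, ← Complex.exp_add, mul_one]
    congr 2 <;> push_cast <;> ring
  rw [e2, norm_div, norm_mul, Complex.norm_exp_ofReal_mul_I, one_mul,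
    Complex.norm_exp_I_mul_ofReal_sub_one]
  simp only [norm_mul, Complex.norm_I, Complex.norm_real, Complex.norm_intCast, Real.norm_eq_abs,
    Complex.norm_ofNat, mul_one, abs_of_pos Real.pi_pos]
  rw [abs_two, mul_assoc, mul_div_mul_left _ _ two_ne_zero, mul_div_cancel_left₀ _ two_ne_zero]

theorem abs_sin_pi_mul_sub_int (x : ℝ) (a : ℤ) :
    |Real.sin (Real.pi * (x - a))| = |Real.sin (Real.pi * x)| := by
  rw [mul_sub, mul_comm Real.pi (a : ℝ), Real.sin_sub_int_mul_pi, abs_mul, abs_zpow]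
  simp

theorem IsArcOfLength.norm_arcCoeff_le {A : Set UnitAddCircle} {ℓ : ℝ} (hA : IsArcOfLength A ℓ)
    {n : ℤ} (hn : n ≠ 0) (a : ℤ) : ‖arcCoeff A n‖ ≤ |ℓ - a / n| := by
  have hn' : (n : ℝ) ≠ 0 := Int.cast_ne_zero.2 hn
  have hn0 : 0 < |(n : ℝ)| := abs_pos.2 hn'
  rw [hA.norm_arcCoeff hn, ← abs_sin_pi_mul_sub_int _ a, div_le_iff₀ (by positivity)]
  refine Real.abs_sin_le_abs.trans_eq ?_
  rw [abs_mul, abs_of_pos Real.pi_pos, mul_left_comm, ← abs_mul]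
  congr 2
  field_simp

theorem IsArcOfLength.exists_le_norm_arcCoeff {A : Set UnitAddCircle} {ℓ : ℝ}
    (hA : IsArcOfLength A ℓ) {n : ℤ} (hn : n ≠ 0) :
    ∃ a : ℤ, 2 / Real.pi * |ℓ - a / n| ≤ ‖arcCoeff A n‖ := by
  have hn' : (n : ℝ) ≠ 0 := Int.cast_ne_zero.2 hn
  have hn0 : 0 < |(n : ℝ)| := abs_pos.2 hn'
  have hpi := Real.pi_pos
  refine ⟨round (n * ℓ), ?_⟩
  have hr := abs_sub_round ((n : ℝ) * ℓ)
  rw [hA.norm_arcCoeff hn, ← abs_sin_pi_mul_sub_int _ (round (n * ℓ)), le_div_iff₀ (by positivity)]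
  refine le_of_eq_of_le ?_ (Real.mul_abs_le_abs_sin (x := Real.pi * (n * ℓ - round (n * ℓ))) ?_)
  · rw [abs_mul, abs_of_pos hpi, show (n : ℝ) * ℓ - round (n * ℓ) =
      (ℓ - round (n * ℓ) / n) * n by field_simp, abs_mul]
    ring
  · rw [abs_mul, abs_of_pos hpi]
    nlinarith

/-- Lengths which are neither rational nor Liouville numbers have arcs with Fourier coefficients
decaying at most polynomially. The denominators `2n` in place of `n` avoid the denominator one,
which the definition of Liouville numbers excludes. -/
theorem IsArcOfLength.exists_pow_le_norm_arcCoeff {A : Set UnitAddCircle} {ℓ : ℝ}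
    (hA : IsArcOfLength A ℓ) (hirr : Irrational ℓ) (hL : ¬ Liouville ℓ) :
    ∃ N : ℕ, ∀ n : ℤ, n ≠ 0 → 2 / Real.pi * (1 / (2 * |(n : ℝ)|) ^ N) ≤ ‖arcCoeff A n‖ := by
  simp only [Liouville, not_forall, not_exists, not_and, not_lt] at hL
  obtain ⟨N, hN⟩ := hL
  refine ⟨N, fun n hn => ?_⟩
  obtain ⟨a, ha⟩ := hA.exists_le_norm_arcCoeff hn
  refine le_trans ?_ ha
  have hn1 : 1 ≤ |n| := Int.one_le_abs hn
  have hn' : (n : ℝ) ≠ 0 := Int.cast_ne_zero.2 hn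
  have key := hN (2 * (n.sign * a)) (2 * |n|) (by omega)
  have e : ((2 * (n.sign * a) : ℤ) : ℝ) / ((2 * |n| : ℤ) : ℝ) = a / n := by
    have h1 : (n : ℝ) = n.sign * |(n : ℝ)| := by
      exact_mod_cast (Int.sign_mul_abs n).symm
    have h2 : (n.sign : ℝ) * n.sign = 1 := by
      have : n.sign * n.sign = 1 := by
        rcases lt_or_gt_of_ne hn with h | h <;>
          simp [Int.sign_eq_neg_one_of_neg, Int.sign_eq_one_of_pos, h]
      exact_mod_cast this
    have h3 : |(n : ℝ)| = n.sign * n := by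
      conv_rhs => rw [h1, ← mul_assoc, h2, one_mul]
    have h4 : (n.sign : ℝ) ≠ 0 := left_ne_zero_of_mul_eq_one h2
    push_cast
    rw [h3]
    field_simp
  rw [e] at key
  have hne : ℓ ≠ a / n := fun h => hirr ⟨(a : ℚ) / n, by rw [h]; push_cast; rfl⟩
  have := key hne
  push_cast at this
  gcongr

theorem exists_rat_approx_of_not {ℓ : ℝ} (h : ¬ (Irrational ℓ ∧ ¬ Liouville ℓ)) (N : ℕ) :
    ∃ (a : ℤ) (b : ℕ), 2 ≤ b ∧ |ℓ - a / b| < 1 / (b : ℝ) ^ N := by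
  by_cases hL : Liouville ℓ
  · obtain ⟨a, b, hb, -, hab⟩ := hL N
    lift b to ℕ using by omega
    exact ⟨a, b, by omega, by simpa using hab⟩
  · have hrat : ¬ Irrational ℓ := fun h' => h ⟨h', hL⟩
    rw [Irrational, not_not] at hrat
    obtain ⟨q, rfl⟩ := hrat
    -- doubling numerator and denominator makes the denominator at least two
    refine ⟨2 * q.num, 2 * q.den, by have := q.den_pos; omega, ?_⟩
    have hq : (q.den : ℝ) ≠ 0 := Nat.cast_ne_zero.2 q.den_nz
    have hq' : (0 : ℝ) < q.den := by have := q.den_pos; positivity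
    have e : (q : ℝ) - ((2 * q.num : ℤ) : ℝ) / ((2 * q.den : ℕ) : ℝ) = 0 := by
      push_cast
      rw [mul_div_mul_left _ _ two_ne_zero, Rat.cast_def, sub_self]
    rw [e, abs_zero]
    push_cast
    positivity

/-- If the length is rational or a Liouville number, the Fourier coefficients of the arc are, on
each progression `mℤ`, smaller than any power along suitable indices. -/
theorem IsArcOfLength.exists_norm_arcCoeff_le {A : Set UnitAddCircle} {ℓ : ℝ}
    (hA : IsArcOfLength A ℓ) (h : ¬ (Irrational ℓ ∧ ¬ Liouville ℓ)) {m : ℤ} (hm : m ≠ 0) (N : ℕ) :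
    ∃ b : ℕ, 2 ≤ b ∧ ‖arcCoeff A (b * m)‖ ≤ 1 / (b : ℝ) ^ N := by
  obtain ⟨a, b, hb, hab⟩ := exists_rat_approx_of_not h N
  refine ⟨b, hb, ?_⟩
  have hb0 : (b : ℤ) ≠ 0 := by omega
  have hm' : (m : ℝ) ≠ 0 := Int.cast_ne_zero.2 hm
  refine (hA.norm_arcCoeff_le (mul_ne_zero hb0 hm) (a * m)).trans (le_of_eq_of_le ?_ hab.le)
  push_cast
  rw [mul_div_mul_right _ _ hm']

/-- A continuous function on the circle, a derivative of which is, up to the mean, a convolution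
inverse of the indicator function of the arc. -/
theorem IsArcOfLength.exists_convolution_inverse {A : Set UnitAddCircle} {ℓ : ℝ}
    (hA : IsArcOfLength A ℓ) (hirr : Irrational ℓ) (hL : ¬ Liouville ℓ) :
    ∃ (k : ℕ) (h : C(UnitAddCircle, ℝ)),
      (∫ r : UnitAddCircle, (h r : ℂ) * fourier 0 r = 0) ∧
      ∀ n : ℤ, n ≠ 0 → arcCoeff A n * ((∫ r : UnitAddCircle, (h r : ℂ) * fourier n r) *
        (2 * Real.pi * Complex.I * n) ^ k) = 1 := by
  obtain ⟨N, hN⟩ := hA.exists_pow_le_norm_arcCoeff hirr hL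
  have hpi := Real.pi_pos
  -- the two extra derivatives make the coefficients of size `O(n⁻²)`
  let b : ℤ → ℂ := fun n =>
    if n = 0 then 0 else (arcCoeff A n * (2 * Real.pi * Complex.I * n) ^ (N + 2))⁻¹
  have hb : Summable fun n => ‖b n‖ := by
    have hs : Summable fun n : ℤ => 1 / Real.pi * (1 / (n : ℝ) ^ 2) :=
      (Real.summable_one_div_int_pow.2 one_lt_two).mul_left _
    refine hs.of_nonneg_of_le (fun n => norm_nonneg _) fun n => ?_
    by_cases hn : n = 0
    · simp [b, hn]
    have hn0 : 0 < |(n : ℝ)| := abs_pos.2 (Int.cast_ne_zero.2 hn)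
    have e : ‖(2 * Real.pi * Complex.I * n : ℂ)‖ = 2 * Real.pi * |(n : ℝ)| := by
      simp [abs_of_pos hpi]
    simp only [b, if_neg hn, norm_inv, norm_mul, norm_pow]
    rw [← norm_mul, ← norm_mul, ← norm_mul, e, one_div_mul_one_div, ← one_div]
    refine one_div_le_one_div_of_le (by positivity) ?_
    calc Real.pi * (n : ℝ) ^ 2 ≤ 8 * Real.pi * |(n : ℝ)| ^ 2 := by
          rw [sq_abs]
          nlinarith [mul_nonneg hpi.le (sq_nonneg (n : ℝ))]
      _ = 2 / Real.pi * (2 * Real.pi * |(n : ℝ)|) ^ 2 := by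
          field_simp
          ring
      _ = 2 / Real.pi * (1 / (2 * |(n : ℝ)|) ^ N) *
            ((2 * |(n : ℝ)|) ^ N * (2 * Real.pi * |(n : ℝ)|) ^ 2) := by
          field_simp
      _ ≤ ‖arcCoeff A n‖ * ((2 * Real.pi * |(n : ℝ)|) ^ N * (2 * Real.pi * |(n : ℝ)|) ^ 2) := by
          gcongr
          · exact hN n hn
          · nlinarith [Real.pi_gt_three]
      _ = _ := by rw [← pow_add]
  have hconj (n : ℤ) : b (-n) = starRingEnd ℂ (b n) := by
    by_cases hn : n = 0
    · simp [b, hn]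
    · simp [b, hn, arcCoeff_neg, map_ofNat]
  obtain ⟨h, hh⟩ := exists_integral_mul_fourier_eq hb hconj
  refine ⟨N + 2, h, by rw [hh]; exact if_pos rfl, fun n hn => ?_⟩
  have hn0 : 0 < |(n : ℝ)| := abs_pos.2 (Int.cast_ne_zero.2 hn)
  have h1 : arcCoeff A n ≠ 0 := norm_pos_iff.1 (lt_of_lt_of_le (by positivity) (hN n hn))
  have h2 : (2 * Real.pi * Complex.I * n : ℂ) ^ (N + 2) ≠ 0 := by
    refine pow_ne_zero _ ?_
    simp [hn, hpi.ne']
  rw [hh]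
  simp only [b, if_neg hn]
  rw [mul_inv]
  field_simp

end ArcCoefficients

/-! ### Inversion of the arc operator -/

section Invertible

open Set Filter MeasureTheory

variable {E : Type*} [NormedAddCommGroup E] [NormedSpace ℝ E] [FiniteDimensional ℝ E]
  {H : Type*} [TopologicalSpace H] {I : ModelWithCorners ℝ E H}
  {M : Type*} [TopologicalSpace M] [ChartedSpace H M] [IsManifold I ∞ M]

omit [FiniteDimensional ℝ E] in
theorem continuous_add_smooth :
    Continuous fun q : C^∞⟮I, M; ℝ⟯ × C^∞⟮I, M; ℝ⟯ => q.1 + q.2 := by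
  refine continuous_iff_continuousAt.2 fun q => tendsto_smooth_iff.2 fun x k K hK hKV ε hε => ?_
  have h1 := tendsto_smooth_iff.1 (continuous_fst.tendsto q) x k K hK hKV (ε / 2) (half_pos hε)
  have h2 := tendsto_smooth_iff.1 (continuous_snd.tendsto q) x k K hK hKV (ε / 2) (half_pos hε)
  filter_upwards [h1, h2] with r hr1 hr2 y hy
  have hsm (g : C^∞⟮I, M; ℝ⟯) := ((g.contMDiff.contDiffOn_comp_extChartAt_symm x) y
    (hKV hy)).of_le (m := k) (mod_cast le_top)
  have e : iteratedFDerivWithin ℝ k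
      (fun z => ((r.1 - q.1) + (r.2 - q.2)) ((extChartAt I x).symm z))
      (extChartAt I x).target y =
      iteratedFDerivWithin ℝ k (fun z => (r.1 - q.1) ((extChartAt I x).symm z))
        (extChartAt I x).target y +
      iteratedFDerivWithin ℝ k (fun z => (r.2 - q.2) ((extChartAt I x).symm z))
        (extChartAt I x).target y :=
    iteratedFDerivWithin_add_apply (hsm _) (hsm _) (uniqueDiffOn_extChartAt_target x) (hKV hy)
  rw [add_sub_add_comm, e]
  exact (norm_add_le _ _).trans_lt ((add_lt_add (hr1 y hy) (hr2 y hy)).trans_eq (add_halves ε))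

variable [AddAction UnitAddCircle M] [SmoothCircleAction I M]

theorem orbitCoeff_arcOperator (A : Set UnitAddCircle) (f : C^∞⟮I, M; ℝ⟯) (p : M) (n : ℤ) :
    orbitCoeff (arcOperator I A f) p n = arcCoeff A n * orbitCoeff f p n := by
  rw [arcOperator_eq_orbitOperator, orbitCoeff_orbitOperator, arcCoeff]
  simp

theorem continuous_arcOperator (A : Set UnitAddCircle) : Continuous (arcOperator I (M := M) A) := by
  rw [arcOperator_eq_orbitOperator]
  exact continuous_orbitOperator _ _

omit [FiniteDimensional ℝ E] in
theorem continuous_generator_pow (k : ℕ) : Continuous (generator I (M := M) ^ k) := by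
  induction k with
  | zero => exact continuous_id
  | succ k ih =>
    rw [pow_succ']
    exact continuous_generator.comp ih

/-- If the Fourier coefficients of the arc do not vanish and decay at most polynomially, the
operator is inverted by a distribution on the circle, a derivative of high order of a continuous
function `h`. -/
theorem isTopInvertible_arcOperator {A : Set UnitAddCircle} {ℓ : ℝ} (hA : IsArcOfLength A ℓ)
    (hirr : Irrational ℓ) (hL : ¬ Liouville ℓ) : IsTopInvertible (arcOperator I (M := M) A) := by
  obtain ⟨k, h, hh0, hh⟩ := hA.exists_convolution_inverse hirr hL
  have hℓ : (ℓ : ℂ) ≠ 0 := Complex.ofReal_ne_zero.2 hirr.ne_zero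
  have hhi : Integrable h (volume : Measure UnitAddCircle) := by
    simpa using integrable_of_continuous_circle h.continuous univ
  -- the zero mode is not seen by the derivatives and is inverted separately by the mean value
  let T : C^∞⟮I, M; ℝ⟯ →ₗ[ℝ] C^∞⟮I, M; ℝ⟯ :=
    orbitOperator I M volume hhi ∘ₗ (generator I ^ k) +
      orbitOperator I M volume (integrable_const ℓ⁻¹)
  have hTcoeff (f : C^∞⟮I, M; ℝ⟯) (p : M) (n : ℤ) :
      arcCoeff A n * orbitCoeff (T f) p n = orbitCoeff f p n := by
    have e : T f = orbitOperator I M volume hhi ((generator I ^ k) f) +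
      orbitOperator I M volume (integrable_const ℓ⁻¹) f := rfl
    rw [e, orbitCoeff_add, orbitCoeff_orbitOperator, orbitCoeff_orbitOperator,
      orbitCoeff_generator_pow, integral_const_mul, integral_fourier_volume]
    by_cases hn : n = 0
    · subst hn
      rw [hh0, hA.arcCoeff_zero, if_pos rfl, zero_mul, zero_add, mul_one, Complex.ofReal_inv,
        mul_inv_cancel_left₀ hℓ]
    · rw [if_neg hn, mul_zero, zero_mul, add_zero, ← mul_assoc, ← mul_assoc,
        mul_assoc (arcCoeff A n), hh n hn, one_mul]
  have hAT (f : C^∞⟮I, M; ℝ⟯) : arcOperator I A (T f) = f :=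
    eq_of_orbitCoeff_eq fun p n => by rw [orbitCoeff_arcOperator, hTcoeff]
  have hcA (n : ℤ) : arcCoeff A n ≠ 0 := by
    by_cases hn : n = 0
    · rwa [hn, hA.arcCoeff_zero]
    · exact left_ne_zero_of_mul_eq_one (hh n hn)
  have hTA (f : C^∞⟮I, M; ℝ⟯) : T (arcOperator I A f) = f :=
    eq_of_orbitCoeff_eq fun p n => mul_left_cancel₀ (hcA n) (by
      rw [hTcoeff, orbitCoeff_arcOperator])
  have hTcont : Continuous T :=
    continuous_add_smooth.comp
      (((continuous_orbitOperator volume hhi).comp (continuous_generator_pow k)).prodMk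
        (continuous_orbitOperator volume (integrable_const ℓ⁻¹)))
  let e : C^∞⟮I, M; ℝ⟯ ≃ₗ[ℝ] C^∞⟮I, M; ℝ⟯ :=
    LinearEquiv.ofLinearMap (arcOperator I A) T (LinearMap.ext hAT) (LinearMap.ext hTA)
  exact ⟨⟨e, continuous_arcOperator A, hTcont⟩, fun _ => rfl⟩

end Invertible

/-! ### Eigenfunctions of the action -/

section Eigenfunctions

open Set Filter MeasureTheory

variable {E : Type*} [NormedAddCommGroup E] [NormedSpace ℝ E] [FiniteDimensional ℝ E]
  {H : Type*} [TopologicalSpace H] {I : ModelWithCorners ℝ E H}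
  {M : Type*} [TopologicalSpace M] [ChartedSpace H M] [IsManifold I ∞ M]
  [AddAction UnitAddCircle M] [SmoothCircleAction I M]

theorem contMDiff_orbitCoeff (f : C^∞⟮I, M; ℝ⟯) (m : ℤ) :
    ContMDiff I 𝓘(ℝ, ℂ) ∞ fun x => orbitCoeff f x m := by
  have hw (w : C(UnitAddCircle, ℝ)) : Integrable w (volume : Measure UnitAddCircle) := by
    simpa using integrable_of_continuous_circle w.continuous univ
  let wr : C(UnitAddCircle, ℝ) := ⟨fun s => (fourier (-m) s : ℂ).re, by fun_prop⟩
  let wi : C(UnitAddCircle, ℝ) := ⟨fun s => (fourier (-m) s : ℂ).im, by fun_prop⟩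
  have h1 : ContMDiff I 𝓘(ℝ, ℝ × ℝ) ∞
      fun x => (orbitIntegral volume wr f x, orbitIntegral volume wi f x) :=
    (contMDiff_orbitIntegral volume (hw wr) f).prodMk_space
      (contMDiff_orbitIntegral volume (hw wi) f)
  refine (Complex.equivRealProdCLM.symm.contDiff.contMDiff.comp h1).congr fun x => ?_
  have hi := integrable_fourier_mul_orbit f x (-m)
  refine Complex.ext ?_ ?_
  · change _ = ∫ s : UnitAddCircle, (fourier (-m) s : ℂ).re * f (s +ᵥ x)
    rw [orbitCoeff]
    refine (integral_re hi).symm.trans ?_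
    congr with s
    exact Complex.re_mul_ofReal _ _
  · change _ = ∫ s : UnitAddCircle, (fourier (-m) s : ℂ).im * f (s +ᵥ x)
    rw [orbitCoeff]
    refine (integral_im hi).symm.trans ?_
    congr with s
    exact Complex.im_mul_ofReal _ _

omit [TopologicalSpace M] in
theorem orbitCoeff_vadd (f : M → ℝ) (r : UnitAddCircle) (x : M) (m : ℤ) :
    orbitCoeff f (r +ᵥ x) m = fourier m r * orbitCoeff f x m := by
  rw [orbitCoeff, orbitCoeff, ← integral_const_mul, ← integral_add_right_eq_self
    (fun s : UnitAddCircle => fourier m r * (fourier (-m) s * (f (s +ᵥ x) : ℂ))) r]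
  congr with s
  have : (fourier (-m) (s + r) : ℂ) = fourier (-m) s * fourier (-m) r := by
    simp [smul_add, AddCircle.toCircle_add]
  have h : (fourier m r : ℂ) * fourier (-m) r = 1 := by
    rw [← fourier_add]
    simp
  rw [this, vadd_vadd]
  linear_combination (-(fourier (-m) s * (f ((s + r) +ᵥ x) : ℂ))) * h

/-- A non-trivial action has a smooth complex eigenfunction of non-zero weight, because smooth
functions separate points and a function without non-zero modes is constant along the orbits. It is
normalized to have maximal modulus one. -/
theorem exists_eigenfunction [T2Space M] [CompactSpace M]
    (hnontrivial : ∃ (s : UnitAddCircle) (x : M), s +ᵥ x ≠ x) :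
    ∃ (m : ℤ) (u : M → ℂ) (p : M), m ≠ 0 ∧ ContMDiff I 𝓘(ℝ, ℂ) ∞ u ∧
      (∀ (s : UnitAddCircle) x, u (s +ᵥ x) = fourier m s * u x) ∧ (∀ x, ‖u x‖ ≤ 1) ∧ u p = 1 := by
  obtain ⟨s, x, hsx⟩ := hnontrivial
  obtain ⟨f, hf0, hf1, -⟩ := exists_contMDiffMap_zero_one_of_isClosed I (n := ⊤)
    (isClosed_singleton (x := s +ᵥ x)) (isClosed_singleton (x := x))
    (disjoint_singleton.2 hsx)
  have hex : ∃ m : ℤ, m ≠ 0 ∧ orbitCoeff f x m ≠ 0 := by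
    by_contra! hcon
    have h1 := orbit_constant_of_orbitCoeff_eq_zero (f := f) hcon s
    have h2 := orbit_constant_of_orbitCoeff_eq_zero (f := f) hcon 0
    rw [zero_vadd, hf1 rfl] at h2
    rw [hf0 rfl, ← h2] at h1
    simp at h1
  obtain ⟨m, hm, hmx⟩ := hex
  have hsm := contMDiff_orbitCoeff f m
  obtain ⟨p, -, hp⟩ := isCompact_univ.exists_isMaxOn ⟨x, mem_univ x⟩
    hsm.continuous.norm.continuousOn
  have hp0 : 0 < ‖orbitCoeff f p m‖ := (norm_pos_iff.2 hmx).trans_le (hp (mem_univ x))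
  refine ⟨m, fun y => (orbitCoeff f p m)⁻¹ * orbitCoeff f y m, p, hm, ?_, ?_, ?_, ?_⟩
  · have hc : ContDiff ℝ ∞ fun z : ℂ => (orbitCoeff f p m)⁻¹ * z := by fun_prop
    exact hc.contMDiff.comp hsm
  · intro r y
    simp only [orbitCoeff_vadd]
    exact mul_left_comm _ _ _
  · intro y
    rw [norm_mul, norm_inv, inv_mul_le_one₀ hp0]
    exact hp (mem_univ y)
  · exact inv_mul_cancel₀ (norm_pos_iff.1 hp0)

omit [FiniteDimensional ℝ E] [IsManifold I ∞ M] [AddAction UnitAddCircle M]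
  [SmoothCircleAction I M] in
theorem contMDiff_re_pow {u : M → ℂ} (hu : ContMDiff I 𝓘(ℝ, ℂ) ∞ u) (c : ℂ) (j : ℕ) :
    ContMDiff I 𝓘(ℝ, ℝ) ∞ fun x => (c * u x ^ j).re := by
  have hz : ContDiff ℝ ∞ fun z : ℂ => c * z ^ j := by fun_prop
  have hc : ContDiff ℝ ∞ fun z : ℂ => (c * z ^ j).re := Complex.reCLM.contDiff.comp hz
  exact hc.contMDiff.comp hu

omit [FiniteDimensional ℝ E] [AddAction UnitAddCircle M] [SmoothCircleAction I M] in
theorem exists_norm_iteratedFDerivWithin_re_pow_le {u : M → ℂ} (hu : ContMDiff I 𝓘(ℝ, ℂ) ∞ u)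
    (hu1 : ∀ x, ‖u x‖ ≤ 1) (x : M) (k : ℕ) {K : Set E} (hK : IsCompact K)
    (hKV : K ⊆ (extChartAt I x).target) :
    ∃ C : ℝ, 0 ≤ C ∧ ∀ (c : ℂ) (j : ℕ), ∀ y ∈ K,
      ‖iteratedFDerivWithin ℝ k (fun z => (c * u ((extChartAt I x).symm z) ^ j).re)
        (extChartAt I x).target y‖ ≤ ‖c‖ * (C * ((j : ℝ) + 1) ^ k) := by
  have hV := uniqueDiffOn_extChartAt_target (I := I) x
  have hw := hu.contDiffOn_comp_extChartAt_symm x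
  obtain ⟨C, hC0, hC⟩ := exists_norm_iteratedFDerivWithin_pow_le hV hw (fun y _ => hu1 _) hK hKV k
  refine ⟨C, hC0, fun c j y hy => ?_⟩
  let L : ℂ →L[ℝ] ℝ := Complex.reCLM ∘L (c • ContinuousLinearMap.id ℝ ℂ)
  have hL : ‖L‖ ≤ ‖c‖ := by
    refine L.opNorm_le_bound (norm_nonneg c) fun z => ?_
    exact (Complex.abs_re_le_norm _).trans_eq (norm_mul c z)
  have e := L.iteratedFDerivWithin_comp_left (i := k)
    ((hw.pow j) y (hKV hy)) hV (hKV hy) (mod_cast le_top)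
  change ‖iteratedFDerivWithin ℝ k (L ∘ fun z => u ((extChartAt I x).symm z) ^ j)
    (extChartAt I x).target y‖ ≤ _
  rw [e]
  refine (L.norm_compContinuousMultilinearMap_le _).trans ?_
  gcongr
  exact hC j y hy

omit [FiniteDimensional ℝ E] in
/-- Powers of an eigenfunction of weight `m` are eigenfunctions, so that the arc operator multiplies
them by a Fourier coefficient of the arc. -/
theorem arcOperator_re_pow (A : Set UnitAddCircle) {u : M → ℂ} (hu : ContMDiff I 𝓘(ℝ, ℂ) ∞ u)
    {m : ℤ} (hum : ∀ (s : UnitAddCircle) x, u (s +ᵥ x) = fourier m s * u x) (j : ℕ) (x : M) :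
    arcOperator I A ⟨fun x => (1 * u x ^ j).re, contMDiff_re_pow hu 1 j⟩ x =
      (arcCoeff A (j * m) * u x ^ j).re := by
  change ∫ s in A, (1 * u (s +ᵥ x) ^ j).re = _
  have e (s : UnitAddCircle) : 1 * u (s +ᵥ x) ^ j = fourier (j * m) s * u x ^ j := by
    rw [hum, mul_pow, one_mul]
    congr 1
    simp [mul_smul, AddCircle.toCircle_nsmul]
  have hc : Continuous fun s : UnitAddCircle => (fourier (j * m) s : ℂ) * u x ^ j := by fun_prop
  simp only [e]
  rw [arcCoeff, ← integral_mul_const]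
  exact integral_re (integrable_of_continuous_circle hc A)

omit [TopologicalSpace M] in
theorem orbitCoeff_re_pow {u : M → ℂ} {m : ℤ}
    (hum : ∀ (s : UnitAddCircle) (x : M), u (s +ᵥ x) = fourier m s * u x) {p : M} (hp : u p = 1)
    (c : ℝ) (j : ℕ) (n : ℤ) :
    orbitCoeff (fun x => ((c : ℂ) * u x ^ j).re) p n =
      (c * (((if j * m = n then 1 else 0) + (if -(j * m) = n then 1 else 0)) / 2) : ℝ) := by
  have e (s : UnitAddCircle) : fourier (-n) s * (((c : ℂ) * u (s +ᵥ p) ^ j).re : ℂ) =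
      (c / 2 : ℂ) * (fourier (j * m - n) s + fourier (-(j * m) - n) s) := by
    have h1 : u (s +ᵥ p) ^ j = fourier (j * m) s := by
      rw [hum, hp, mul_one]
      simp [mul_smul, AddCircle.toCircle_nsmul]
    rw [h1, Complex.re_eq_add_conj, map_mul, Complex.conj_ofReal, ← fourier_neg, sub_eq_add_neg,
      sub_eq_add_neg, fourier_add, fourier_add]
    ring
  have hi (n : ℤ) : Integrable (fun s : UnitAddCircle => (fourier n s : ℂ)) := by
    have := integrable_of_continuous_circle (fourier n : C(UnitAddCircle, ℂ)).continuous univ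
    rwa [Measure.restrict_univ] at this
  rw [orbitCoeff]
  simp only [e]
  rw [integral_const_mul, integral_add (hi _) (hi _), integral_fourier_volume,
    integral_fourier_volume]
  simp only [sub_eq_zero]
  push_cast
  split_ifs <;> simp <;> ring

end Eigenfunctions

/-! ### Rational and Liouville lengths -/

section NonInvertible

open Set Filter MeasureTheory

/-- If `b ≥ 2`, then `b ^ (-i)` beats the polynomial `(b + 1) ^ k` for large `i`, uniformly in
`b`. -/
theorem one_div_pow_mul_add_one_pow_le {b : ℕ} (hb : 2 ≤ b) {i k : ℕ} (hki : k ≤ i) :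
    1 / (b : ℝ) ^ i * ((b : ℝ) + 1) ^ k ≤ 4 ^ k * (1 / 2) ^ i := by
  obtain ⟨l, rfl⟩ := Nat.exists_eq_add_of_le hki
  have hb2 : (2 : ℝ) ≤ b := by exact_mod_cast hb
  have hb0 : (0 : ℝ) < b := by linarith
  calc 1 / (b : ℝ) ^ (k + l) * ((b : ℝ) + 1) ^ k
      ≤ 1 / (b : ℝ) ^ (k + l) * (2 * (b : ℝ)) ^ k := by
        gcongr
        linarith
    _ = 2 ^ k * (1 / (b : ℝ)) ^ l := by
        rw [pow_add, mul_pow, one_div_pow]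
        field_simp
    _ ≤ 2 ^ k * (1 / 2) ^ l := by gcongr
    _ = 4 ^ k * (1 / 2) ^ (k + l) := by
        rw [pow_add, ← mul_assoc, ← mul_pow]
        norm_num

variable {E : Type*} [NormedAddCommGroup E] [NormedSpace ℝ E] [FiniteDimensional ℝ E]
  {H : Type*} [TopologicalSpace H] {I : ModelWithCorners ℝ E H}
  {M : Type*} [TopologicalSpace M] [ChartedSpace H M] [IsManifold I ∞ M]
  [T2Space M] [CompactSpace M]
  [AddAction UnitAddCircle M] [SmoothCircleAction I M]

/-- Small Fourier coefficients of the arc give functions of supremum norm one with small images. -/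
theorem not_isEmbedding_arcOperator (hnontrivial : ∃ (s : UnitAddCircle) (x : M), s +ᵥ x ≠ x)
    {A : Set UnitAddCircle} {ℓ : ℝ} (hA : IsArcOfLength A ℓ)
    (h : ¬ (Irrational ℓ ∧ ¬ Liouville ℓ)) :
    ¬ Topology.IsEmbedding (arcOperator I (M := M) A) := by
  intro hemb
  obtain ⟨m, u, p, hm, hu, hum, hu1, hp⟩ := exists_eigenfunction (I := I) hnontrivial
  choose b hb2 hb using hA.exists_norm_arcCoeff_le h hm
  let F : ℕ → C^∞⟮I, M; ℝ⟯ := fun i =>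
    ⟨fun x => (1 * u x ^ b i).re, contMDiff_re_pow hu 1 (b i)⟩
  have hlim : Tendsto (fun i => arcOperator I A (F i)) atTop (𝓝 (arcOperator I A 0)) := by
    rw [map_zero]
    refine tendsto_smooth_iff.2 fun x k K hK hKV ε hε => ?_
    obtain ⟨C, hC0, hC⟩ := exists_norm_iteratedFDerivWithin_re_pow_le hu hu1 x k hK hKV
    have h0 : Tendsto (fun i : ℕ => C * (4 ^ k * (1 / 2 : ℝ) ^ i)) atTop (𝓝 0) := by
      simpa using ((tendsto_pow_atTop_nhds_zero_of_lt_one (r := (1 / 2 : ℝ)) (by norm_num)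
        (by norm_num)).const_mul (4 ^ k)).const_mul C
    filter_upwards [h0.eventually_lt_const hε, eventually_ge_atTop k] with i hi hik y hy
    have e : (fun z => (arcOperator I A (F i) - 0) ((extChartAt I x).symm z)) =
        fun z => (arcCoeff A (b i * m) * u ((extChartAt I x).symm z) ^ b i).re := by
      funext z
      rw [sub_zero]
      exact arcOperator_re_pow A hu hum (b i) _
    rw [e]
    refine (hC _ _ y hy).trans_lt (lt_of_le_of_lt ?_ hi)
    calc _ ≤ 1 / (b i : ℝ) ^ i * (C * ((b i : ℝ) + 1) ^ k) := by
          gcongr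
          exact hb i
      _ = C * (1 / (b i : ℝ) ^ i * ((b i : ℝ) + 1) ^ k) := by ring
      _ ≤ _ := by
          gcongr C * ?_
          exact one_div_pow_mul_add_one_pow_le (hb2 i) hik
  have hF : Tendsto F atTop (𝓝 0) := (hemb.isInducing.tendsto_nhds_iff).2 hlim
  have hFp : Tendsto (fun i => F i p) atTop (𝓝 ((0 : C^∞⟮I, M; ℝ⟯) p)) :=
    ((continuous_eval_smooth p).tendsto _).comp hF
  have e (i : ℕ) : F i p = 1 := by
    change (1 * u p ^ b i).re = 1
    rw [hp]
    simp
  simp only [e] at hFp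
  have := tendsto_nhds_unique tendsto_const_nhds hFp
  exact one_ne_zero this

omit [FiniteDimensional ℝ E] [T2Space M] [CompactSpace M] [AddAction UnitAddCircle M]
  [SmoothCircleAction I M] in
theorem summable_one_div_pow_mul (b : ℕ → ℕ) (hb : ∀ i, 2 ≤ b i) (k : ℕ) :
    Summable fun i : ℕ => 1 / (b i : ℝ) ^ i * ((b i : ℝ) + 1) ^ k := by
  have hs : Summable fun i : ℕ => 4 ^ k * (1 / 2 : ℝ) ^ i :=
    (summable_geometric_of_lt_one (by norm_num) (by norm_num)).mul_left _
  refine Summable.of_norm_bounded_eventually_nat hs ?_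
  filter_upwards [eventually_ge_atTop k] with i hi
  rw [Real.norm_of_nonneg (by positivity)]
  exact one_div_pow_mul_add_one_pow_le (hb i) hi

omit [T2Space M] [CompactSpace M] [AddAction UnitAddCircle M] [SmoothCircleAction I M] in
/-- A lacunary power series in `u` with rapidly decreasing coefficients is smooth up to the
boundary of the unit disc. It is written as an integral over the counting measure. -/
theorem contMDiff_integral_count_re_pow {u : M → ℂ} (hu : ContMDiff I 𝓘(ℝ, ℂ) ∞ u)
    (hu1 : ∀ x, ‖u x‖ ≤ 1) (b : ℕ → ℕ) (hb : ∀ i, 2 ≤ b i) :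
    ContMDiff I 𝓘(ℝ, ℝ) ∞ fun x =>
      ∫ i, (((1 / (b i : ℝ) ^ i : ℝ) : ℂ) * u x ^ b i).re ∂(Measure.count : Measure ℕ) := by
  refine contMDiff_of_contDiffOn_extChartAt fun x => ?_
  obtain ⟨O, hO, hxO, hconv, K, hK, hOK, hKV⟩ :=
    exists_convex_extChartAt_target_inter (I := I) x (mem_extChartAt_target x)
  refine ⟨O, hO, hxO, ?_⟩
  have hbd (k : ℕ) := exists_norm_iteratedFDerivWithin_re_pow_le hu hu1 x k hK hKV
  choose C hC0 hC using hbd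
  refine (hasFTaylorSeriesUpToOn_integral_of_dominated (μ := (Measure.count : Measure ℕ)) hconv
    ((uniqueDiffOn_extChartAt_target x).inter hO)
    (f := fun i z =>
      (((1 / (b i : ℝ) ^ i : ℝ) : ℂ) * u ((extChartAt I x).symm z) ^ b i).re)
    (fun i => ((contMDiff_re_pow hu _ (b i)).contDiffOn_comp_extChartAt_symm x).mono
      inter_subset_left)
    (fun k y hy => StronglyMeasurable.of_discrete.aestronglyMeasurable)
    (B := fun k i => C k * (1 / (b i : ℝ) ^ i * ((b i : ℝ) + 1) ^ k))
    (fun k => integrable_count_iff.2 ((summable_one_div_pow_mul b hb k).mul_left (C k)).norm)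
    (fun k i y hy => ?_)).contDiffOn
  rw [iteratedFDerivWithin_inter_open hO hy.2]
  refine (hC k _ (b i) y (hOK hy)).trans_eq ?_
  rw [Complex.norm_real, Real.norm_of_nonneg (by positivity)]
  ring

/-- If the Fourier coefficients `c` of the arc are too small along `b i * m`, a lacunary series in
the powers of an eigenfunction has no preimage: its coefficients, divided by `c`, are unbounded. -/
theorem not_surjective_arcOperator (hnontrivial : ∃ (s : UnitAddCircle) (x : M), s +ᵥ x ≠ x)
    {A : Set UnitAddCircle} {ℓ : ℝ} (hA : IsArcOfLength A ℓ)
    (h : ¬ (Irrational ℓ ∧ ¬ Liouville ℓ)) :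
    ¬ Function.Surjective (arcOperator I (M := M) A) := by
  intro hsurj
  obtain ⟨m, u, p, hm, hu, hum, hu1, hp⟩ := exists_eigenfunction (I := I) hnontrivial
  -- the exponent `2 * i` leaves a factor `b i ^ i` over the coefficients `b i ^ (-i)`
  choose b hb2 hb using fun i => hA.exists_norm_arcCoeff_le h hm (2 * i)
  obtain ⟨g, hg⟩ := hsurj ⟨_, contMDiff_integral_count_re_pow hu hu1 b hb2⟩
  have hs0 : Summable fun i : ℕ => 1 / (b i : ℝ) ^ i := by
    simpa using summable_one_div_pow_mul b hb2 0
  have ha0 (i : ℕ) : 0 ≤ 1 / (b i : ℝ) ^ i := by positivity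
  -- the Fourier coefficients of the series have non-negative terms, so no cancellation occurs
  let κ : ℤ → ℕ → ℝ := fun n i =>
    1 / (b i : ℝ) ^ i * (((if b i * m = n then 1 else 0) + (if -(b i * m) = n then 1 else 0)) / 2)
  have hκ0 (n : ℤ) (i : ℕ) : 0 ≤ κ n i := by
    refine mul_nonneg (ha0 i) (div_nonneg (add_nonneg ?_ ?_) zero_le_two) <;> split_ifs <;> simp
  have hκ1 (n : ℤ) (i : ℕ) : κ n i ≤ 1 / (b i : ℝ) ^ i := by
    refine mul_le_of_le_one_right (ha0 i) ?_
    split_ifs <;> norm_num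
  have hκs (n : ℤ) : Summable (κ n) := hs0.of_nonneg_of_le (hκ0 n) (hκ1 n)
  have hcoeff (n : ℤ) : orbitCoeff (arcOperator I A g) p n = (∑' i, κ n i : ℝ) := by
    rw [hg]
    have hcont (i : ℕ) : Continuous fun s : UnitAddCircle =>
        fourier (-n) s * (((((1 / (b i : ℝ) ^ i : ℝ) : ℂ) * u (s +ᵥ p) ^ b i).re : ℝ) : ℂ) :=
      (fourier (-n)).continuous.mul (continuous_orbit_ofReal
        (⟨_, contMDiff_re_pow hu ((1 / (b i : ℝ) ^ i : ℝ) : ℂ) (b i)⟩ : C^∞⟮I, M; ℝ⟯) p)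
    have hbound (i : ℕ) (x : M) :
        ‖(((1 / (b i : ℝ) ^ i : ℝ) : ℂ) * u x ^ b i).re‖ ≤ 1 / (b i : ℝ) ^ i := by
      refine (Complex.abs_re_le_norm _).trans ?_
      rw [norm_mul, Complex.norm_real, Real.norm_of_nonneg (ha0 i), norm_pow]
      exact mul_le_of_le_one_right (ha0 i) (pow_le_one₀ (norm_nonneg _) (hu1 x))
    have hI (i : ℕ) : Integrable (fun s : UnitAddCircle =>
        fourier (-n) s * (((((1 / (b i : ℝ) ^ i : ℝ) : ℂ) * u (s +ᵥ p) ^ b i).re : ℝ) : ℂ)) := by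
      have := integrable_of_continuous_circle (hcont i) univ
      rwa [Measure.restrict_univ] at this
    have hsum := hasSum_integral_of_summable_integral_norm hI
      (hs0.of_nonneg_of_le (fun i => integral_nonneg fun s => norm_nonneg _) fun i => by
        refine (integral_mono (hI i).norm (integrable_const (1 / (b i : ℝ) ^ i)) fun s => ?_).trans
          (by simp [measureReal_def])
        simp only [norm_mul, norm_fourier_apply, one_mul, Complex.norm_real]
        exact hbound i _)
    have hterm (i : ℕ) := orbitCoeff_re_pow hum hp (1 / (b i : ℝ) ^ i) (b i) n
    simp only [orbitCoeff] at hterm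
    simp only [hterm] at hsum
    rw [Complex.ofReal_tsum, hsum.tsum_eq, orbitCoeff]
    congr with s
    rw [tsum_mul_left, ← Complex.ofReal_tsum]
    congr 2
    have hint : Integrable (fun i => (((1 / (b i : ℝ) ^ i : ℝ) : ℂ) * u (s +ᵥ p) ^ b i).re)
        (Measure.count : Measure ℕ) :=
      integrable_count_iff.2 (hs0.of_nonneg_of_le (fun i => norm_nonneg _) fun i => hbound i _)
    change ∫ i, (((1 / (b i : ℝ) ^ i : ℝ) : ℂ) * u (s +ᵥ p) ^ b i).re
      ∂(Measure.count : Measure ℕ) = _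
    rw [integral_countable hint]
    simp [measureReal_def]
  obtain ⟨C, hC⟩ := norm_orbitCoeff_le g p
  have hpow (i : ℕ) : (2 : ℝ) ^ i ≤ 2 * C := by
    have hb0 : (2 : ℝ) ≤ b i := by exact_mod_cast hb2 i
    have h1 : 1 / (b i : ℝ) ^ i / 2 ≤ ∑' l, κ (b i * m) l := by
      refine le_trans ?_ ((hκs _).le_tsum i fun l _ => hκ0 _ l)
      simp only [κ, if_true]
      rw [div_eq_mul_inv _ (2 : ℝ)]
      gcongr
      split_ifs <;> norm_num
    have h2 : ∑' l, κ (b i * m) l ≤ 1 / (b i : ℝ) ^ (2 * i) * C := by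
      refine (le_abs_self _).trans ?_
      rw [← Real.norm_eq_abs, ← Complex.norm_real, ← hcoeff, orbitCoeff_arcOperator, norm_mul]
      gcongr
      · exact hb i
      · exact hC _
    have h3 := h1.trans h2
    have hbi : 0 < (b i : ℝ) ^ i := by positivity
    rw [mul_comm 2 i, pow_mul, div_div, div_le_iff₀ (by positivity)] at h3
    have e : 1 / ((b i : ℝ) ^ i) ^ 2 * C * ((b i : ℝ) ^ i * 2) = 2 * C / (b i : ℝ) ^ i := by
      field_simp
    rw [e, le_div_iff₀ hbi, one_mul] at h3
    exact (pow_le_pow_left₀ zero_le_two hb0 i).trans h3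
  obtain ⟨i, hi⟩ := pow_unbounded_of_one_lt (2 * C) (one_lt_two (α := ℝ))
  exact absurd (hpow i) (not_le.2 hi)

end NonInvertible

/-! ### Equivalence of the conditions -/

theorem mainTheorem5
    {E : Type*} [NormedAddCommGroup E] [NormedSpace ℝ E] [FiniteDimensional ℝ E]
    {H : Type*} [TopologicalSpace H] (I : ModelWithCorners ℝ E H)
    {M : Type*} [TopologicalSpace M] [ChartedSpace H M] [IsManifold I ∞ M]
    [T2Space M] [CompactSpace M]
    [AddAction UnitAddCircle M] [SmoothCircleAction I M]
    (hnontrivial : ∃ (s : UnitAddCircle) (x : M), s +ᵥ x ≠ x) :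
    (∀ (A : Set UnitAddCircle) (ℓ : ℝ), IsArcOfLength A ℓ →
      List.TFAE [
        IsTopInvertible (arcOperator I (M := M) A),
        Topology.IsEmbedding (arcOperator I (M := M) A),
        Function.Surjective (arcOperator I (M := M) A),
        Irrational ℓ ∧ ¬ Liouville ℓ]) ∧
    MeasureTheory.volume {ℓ : ℝ | ∃ A : Set UnitAddCircle, IsArcOfLength A ℓ ∧
      ¬ IsTopInvertible (arcOperator I (M := M) A)} = 0 := by
  refine ⟨fun A ℓ hA => ?_, ?_⟩
  · tfae_have 1 → 2 := by
      rintro ⟨e, he⟩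
      rw [← show ⇑e = arcOperator I (M := M) A from funext he]
      exact e.toHomeomorph.isEmbedding
    tfae_have 1 → 3 := by
      rintro ⟨e, he⟩
      rw [← show ⇑e = arcOperator I (M := M) A from funext he]
      exact e.surjective
    tfae_have 2 → 4 := fun h => by
      by_contra hcon
      exact not_isEmbedding_arcOperator hnontrivial hA hcon h
    tfae_have 3 → 4 := fun h => by
      by_contra hcon
      exact not_surjective_arcOperator hnontrivial hA hcon h
    tfae_have 4 → 1 := fun h => isTopInvertible_arcOperator hA h.1 h.2
    tfae_finish
  · refine MeasureTheory.measure_mono_null (t := Set.range ((↑) : ℚ → ℝ) ∪ {ℓ | Liouville ℓ}) ?_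
      (MeasureTheory.measure_union_null ((Set.countable_range _).measure_zero _)
        volume_setOfPred_liouville)
    rintro ℓ ⟨A, hA, hinv⟩
    by_contra hcon
    rw [Set.mem_union, not_or] at hcon
    exact hinv (isTopInvertible_arcOperator hA hcon.1 hcon.2)
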